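/- All graphs are finite and simple, and a coloring means an edge-coloring with colors in $\mathbb{N}$. Let $K_r^t$ denote the complete $r$-partite graph all of whose partite sets have size $t$. A coloring $c$ of a graph $G$ is extremal for $\mathrm{ar}(G,H)$ if it has no rainbow copy of $H$ (a copy of $H$ whose edges have pairwise distinct colors) and uses the maximum number of colors among all colorings of $G$ with no rainbow copy of $H$. A color is saturated by a vertex $v$ of a colored graph if it appears on an edge and every edge of that color is incident to $v$; let $S(v)$ be the set of colors saturated by $v$. Nonadjacent vertices $u,v$ are symmetric in the colored graph if $N(u)=N(v)$ and there is a bijection $\sigma:S(u)\to S(v)$ such that for every $x\in N(u)$, $c(vx)=c(ux)$ if $c(ux)\notin S(u)$, and $c(vx)=\sigma(c(ux))$ if $c(ux)\in S(u)$. A coloring of a complete multipartite graph is totally symmetric if any two vertices in a common partite set are symmetric. For a coloring $c_K$ of $K_r$ on $\{v_1,\dots,v_r\}$, its $t$-blow-up is the coloring of $K_r^t$ with partite sets $U_i=\{u_i^1,\dots,u_i^t\}$, unique up to renaming colors, defined as follows: for each color $a$ of $c_K$ and each edge $v_iv_j$ of color $a$, the edge $u_i^pu_j^q$ receives the color $a$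 if no vertex of $K_r$ saturates $a$; a color $a_p$ depending only on $a$ and $p$ if $v_i$ is the only vertex saturating $a$; and a color $a_{p,q}$ of its own if both $v_i$ and $v_j$ saturate $a$ (all these new colors being distinct). **Theorem.** Let $r>k\ge 4$ and $t\ge 2$, and let $c$ be a totally symmetric extremal coloring for $\mathrm{ar}(K_r^t,K_k)$. Then, up to renaming colors, $c$ is the $t$-blow-up of a coloring $c_K$ of $K_r$ for which there is a spanning subgraph $L$ of $K_r$ such that $L$ is rainbow in $c_K$, all edges of $K_r$ outside $L$ have one common color that does not occur on $L$, and one of the following holds: 1. $k=4$, $r=5$, and $L$ is isomorphic to the hourglass (two triangles sharing exactly one vertex) or to the house (a $4$-cycle and a triangle sharing exactly one edge); 2. $k=4$, $r=6$, and $L$ is isomorphic to the prism (two disjoint triangles joined by a perfect matching); 3. $L$ is isomorphic to the Turán graph $T_{r,k-2}$, the complete $(k-2)$-partite graph on $r$ vertices whose partite sets differ in size by at most one. -/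

import Mathlib

namespace AntiRamsey

open SimpleGraph

/-- The number `c(G)` of colours used by an edge-colouring `c` of `G`. -/
noncomputable def numColors {V α : Type*} {G : SimpleGraph V} (c : EdgeLabeling G α) : ℕ :=
  (Set.range c).ncard

/-- The colouring `c` of `G` contains no rainbow copy of `H`, that is, no copy of `H` whose edges
have pairwise different colours. -/
def RainbowFree {V W α : Type*} {G : SimpleGraph V} (H : SimpleGraph W)
    (c : EdgeLabeling G α) : Prop :=
  ∀ φ : Copy H G, ¬ Function.Injective (c.pullback φ.toHom)

/-- `c` is an extremal colouring for the anti-Ramsey number `ar(G, H)`: it has no rainbow copy of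
`H`, and it uses the maximum number of colours among all such colourings. -/
def IsExtremalColoring {V W : Type*} {G : SimpleGraph V} (H : SimpleGraph W)
    (c : EdgeLabeling G ℕ) : Prop :=
  RainbowFree H c ∧ ∀ c' : EdgeLabeling G ℕ, RainbowFree H c' → numColors c' ≤ numColors c

/-- The set of colours saturated by the vertex `v`: colours that appear at `v` and all of whose
edges are incident to `v`. -/
def saturated {V α : Type*} {G : SimpleGraph V} (c : EdgeLabeling G α) (v : V) : Set α :=
  {a | (∃ e : G.edgeSet, v ∈ (e : Sym2 V) ∧ c e = a) ∧
    ∀ e : G.edgeSet, c e = a → v ∈ (e : Sym2 V)}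

/-- The nonadjacent vertices `u` and `v` are symmetric in the coloured graph: they have the same
neighbours, and there is a bijection `σ` from the colours saturated by `u` to the colours saturated
by `v` such that, for every common neighbour `x`, `c(vx) = c(ux)` if `c(ux)` is not saturated by
`u`, and `c(vx) = σ(c(ux))` if it is. -/
def SymmetricVertices {V α : Type*} {G : SimpleGraph V} (c : EdgeLabeling G α) (u v : V) : Prop :=
  ¬ G.Adj u v ∧ G.neighborSet u = G.neighborSet v ∧
    ∃ σ : saturated c u ≃ saturated c v, ∀ (x : V) (hu : G.Adj u x) (hv : G.Adj v x),
      (c.get u x hu ∉ saturated c u → c.get v x hv = c.get u x hu) ∧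
      (∀ h : c.get u x hu ∈ saturated c u, c.get v x hv = σ ⟨c.get u x hu, h⟩)

/-- A colouring of a complete multipartite graph is totally symmetric if any two vertices in a
common partite set are symmetric. -/
def TotallySymmetric {ι α : Type*} {U : ι → Type*}
    (c : EdgeLabeling (completeMultipartiteGraph U) α) : Prop :=
  ∀ (i : ι) (x y : U i), SymmetricVertices c ⟨i, x⟩ ⟨i, y⟩

/-- The blow-up of `G` with size function `f`. -/
abbrev blowUp {V : Type*} (G : SimpleGraph V) (f : V → ℕ) : SimpleGraph (Σ v : V, Fin (f v)) :=
  G.comap Sigma.fst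

/-- The projection of a blow-up to the original graph. -/
def blowUpProj {V : Type*} (G : SimpleGraph V) (f : V → ℕ) : blowUp G f →g G :=
  ⟨Sigma.fst, fun h => h⟩

/-- The blow-up of a coloured graph. An edge `e` lying over an edge `e'` of `G` with `c(e') = a`
receives the colour `a` indexed by the set of those endpoints `x` of `e` for which `a` is saturated
by the vertex of `G` below `x`. Thus for `e = xy` the new colour is

* `(a, ∅)`, the same for all edges over edges of colour `a`, if no vertex of `G` saturates `a`;
* `(a, {x})`, one colour for each vertex `x` over `v`, if `v` is the only vertex saturating `a`;
* `(a, {x, y})`, an exclusive colour for each edge over `e'`, if two vertices saturate `a`. -/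
def blowUpColoring {V α : Type*} {G : SimpleGraph V} (c : EdgeLabeling G α) (f : V → ℕ) :
    EdgeLabeling (blowUp G f) (α × Set (Σ v : V, Fin (f v))) :=
  fun e => (c ((blowUpProj G f).mapEdgeSet e),
    {x | x ∈ (e : Sym2 _) ∧ c ((blowUpProj G f).mapEdgeSet e) ∈ saturated c x.1})

/-- The graph isomorphism `ρ` is an isomorphism of coloured graphs: together with some bijection
between the sets of used colours it respects the colourings. -/
def IsColoredIso {V W α β : Type*} {G : SimpleGraph V} {G' : SimpleGraph W}
    (c : EdgeLabeling G α) (c' : EdgeLabeling G' β) (ρ : G ≃g G') : Prop :=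
  ∃ σ : Set.range c ≃ Set.range c', ∀ e : G.edgeSet,
    (σ ⟨c e, Set.mem_range_self e⟩ : β) = c' (ρ.mapEdgeSet e)

/-- In the colouring `c` of the complete graph on `V`, the subgraph `L` is rainbow and all other
edges have one extra common colour, not used on `L`. -/
def IsRainbowPlusOne {V α : Type*} (c : TopEdgeLabeling V α) (L : SimpleGraph V) : Prop :=
  (∀ e₁ e₂ : (⊤ : SimpleGraph V).edgeSet, (e₁ : Sym2 V) ∈ L.edgeSet → (e₂ : Sym2 V) ∈ L.edgeSet →
    c e₁ = c e₂ → e₁ = e₂) ∧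
  ∃ a : α, ∀ e : (⊤ : SimpleGraph V).edgeSet, (e : Sym2 V) ∉ L.edgeSet ↔ c e = a

/-- Two triangles sharing exactly one vertex. -/
def hourglass : SimpleGraph (Fin 5) :=
  fromEdgeSet {s(0, 1), s(0, 2), s(1, 2), s(2, 3), s(2, 4), s(3, 4)}

/-- A 4-cycle and a triangle sharing exactly one edge. -/
def house : SimpleGraph (Fin 5) :=
  fromEdgeSet {s(0, 1), s(1, 2), s(2, 3), s(3, 0), s(2, 4), s(3, 4)}

/-- Two disjoint triangles joined by a perfect matching. -/
def prism : SimpleGraph (Fin 6) :=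
  fromEdgeSet {s(0, 1), s(0, 2), s(1, 2), s(3, 4), s(3, 5), s(4, 5), s(0, 3), s(1, 4), s(2, 5)}

end AntiRamsey

/-! Write p = k - 2 and let T be the number of edges of the Turán graph with p parts on r vertices.
Restrict c to a transversal of the partite sets to get a colouring f of K_r without rainbow K_k, and
let b be the t-blow-up of f. Total symmetry makes b refine c: the colour of an edge over ij arises
from f(ij) by symmetry maps that move only saturated colours (`eq_of_blowUpColoring_eq`). Blowing up
creates no rainbow K_k (`rainbowFree_blowUpColoring`), so by extremality b has no more colours than
c, and the two have the same colour classes.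

It remains to identify f. Let m of its colours occur on exactly one edge and n' on several. The
former give at most t² colours of b each, the latter at most t, because a colour saturated by two
vertices has only one edge. Colouring the blow-up of the Turán graph rainbow, with one further
colour elsewhere, yields t²T + 1 ≤ t²m + tn'. The anti-Ramsey theorem for cliques (`card_colors_le`)
gives m + n' ≤ T + 1, and n' ≥ 1 since f is not rainbow. For t ≥ 2 this forces m = T and n' = 1. So
f is rainbow on the graph L of edges with a colour of their own and constant elsewhere, and every
k-set misses at least two edges of L.

Such graphs with T edges are classified in `iso_of_card_edgeFinset_eq`: without K_{p+1} Turán's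
theorem applies, and with one, counting edges around it is tight only for p = 2 and 5 or 6 vertices.

The anti-Ramsey bound is proved by deleting vertices. If it fails, every vertex takes many colours
with it; one edge per lost colour gives a digraph of large outdegree, whose transitive tournaments
grow into a rainbow K_{p+2}. -/

namespace AntiRamsey

open Finset

/-! ### The anti-Ramsey bound for complete graphs -/

section Rainbow

variable {V α : Type*} [DecidableEq V]

/-- The edges of the complete graph on the finite vertex set `U`. -/
def pairs (U : Finset V) : Finset (Sym2 V) := U.offDiag.image Sym2.mk.uncurry

lemma mk_mem_pairs {U : Finset V} {x y : V} : s(x, y) ∈ pairs U ↔ x ∈ U ∧ y ∈ U ∧ x ≠ y := by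
  simp only [pairs, mem_image, mem_offDiag, Prod.exists, Function.uncurry]
  constructor
  · rintro ⟨a, b, ⟨ha, hb, hab⟩, h⟩
    rcases Sym2.eq_iff.1 h with ⟨rfl, rfl⟩ | ⟨rfl, rfl⟩
    · exact ⟨ha, hb, hab⟩
    · exact ⟨hb, ha, hab.symm⟩
  · rintro ⟨hx, hy, hxy⟩
    exact ⟨x, y, ⟨hx, hy, hxy⟩, rfl⟩

lemma card_pairs (U : Finset V) : (pairs U).card = U.card.choose 2 := Sym2.card_image_offDiag U

/-- The edges of the complete graph on `X` have pairwise different colours. -/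
def RainbowOn (f : Sym2 V → α) (X : Finset V) : Prop := Set.InjOn f (pairs X)

lemma RainbowOn.mono {f : Sym2 V → α} {X Y : Finset V} (h : RainbowOn f Y) (hXY : X ⊆ Y) :
    RainbowOn f X := by
  refine Set.InjOn.mono ?_ h
  intro e
  induction e using Sym2.ind with
  | _ x y =>
    simp only [mem_coe, mk_mem_pairs]
    exact fun ⟨hx, hy, hxy⟩ => ⟨hXY hx, hXY hy, hxy⟩

variable [DecidableEq α]

/-- The colours of the colouring `f` on the complete graph on `U`. -/
def colors (f : Sym2 V → α) (U : Finset V) : Finset α := (pairs U).image f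

lemma mem_colors {f : Sym2 V → α} {U : Finset V} {a : α} :
    a ∈ colors f U ↔ ∃ x ∈ U, ∃ y ∈ U, x ≠ y ∧ f s(x, y) = a := by
  simp only [colors, mem_image]
  constructor
  · rintro ⟨e, he, rfl⟩
    induction e using Sym2.ind with
    | _ x y =>
      obtain ⟨hx, hy, hxy⟩ := mk_mem_pairs.1 he
      exact ⟨x, hx, y, hy, hxy, rfl⟩
  · rintro ⟨x, hx, y, hy, hxy, rfl⟩
    exact ⟨_, mk_mem_pairs.2 ⟨hx, hy, hxy⟩, rfl⟩

/-- The colours on `U` that are lost when the vertex `v` is deleted. -/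
def lostColors (f : Sym2 V → α) (U : Finset V) (v : V) : Finset α :=
  colors f U \ colors f (U.erase v)

lemma colors_mono (f : Sym2 V → α) {U W : Finset V} (h : U ⊆ W) : colors f U ⊆ colors f W := by
  intro a ha
  obtain ⟨x, hx, y, hy, hxy⟩ := mem_colors.1 ha
  exact mem_colors.2 ⟨x, h hx, y, h hy, hxy⟩

lemma mem_of_color_mem_lostColors {f : Sym2 V → α} {U : Finset V} {v x y : V}
    (h : f s(x, y) ∈ lostColors f U v) (hx : x ∈ U) (hy : y ∈ U) (hxy : x ≠ y) :
    v = x ∨ v = y := by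
  by_contra! hv
  exact (mem_sdiff.1 h).2 (mem_colors.2
    ⟨x, mem_erase.2 ⟨hv.1.symm, hx⟩, y, mem_erase.2 ⟨hv.2.symm, hy⟩, hxy, rfl⟩)

/-- One edge at `v` is chosen for every colour lost with `v`. -/
lemma exists_representatives (f : Sym2 V → α) (U : Finset V) (v : V) :
    ∃ R ⊆ U.erase v, R.card = (lostColors f U v).card ∧
      Set.InjOn (fun x => f s(v, x)) R ∧ ∀ x ∈ R, f s(v, x) ∈ lostColors f U v := by
  have key : ∀ a ∈ lostColors f U v, ∃ x ∈ U.erase v, f s(v, x) = a := by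
    intro a ha
    obtain ⟨x, hx, y, hy, hxy, rfl⟩ := mem_colors.1 (mem_sdiff.1 ha).1
    rcases mem_of_color_mem_lostColors ha hx hy hxy with rfl | rfl
    · exact ⟨y, mem_erase.2 ⟨hxy.symm, hy⟩, rfl⟩
    · exact ⟨x, mem_erase.2 ⟨hxy, hx⟩, by rw [Sym2.eq_swap]⟩
  have : Nonempty V := ⟨v⟩
  choose! g hgU hg using key
  refine ⟨(lostColors f U v).image g, ?_, ?_, ?_, ?_⟩
  · exact image_subset_iff.2 hgU
  · refine card_image_of_injOn fun a ha b hb hab => ?_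
    rw [← hg a ha, ← hg b hb, hab]
  · intro x hx y hy hxy
    obtain ⟨a, ha, rfl⟩ := mem_image.1 (mem_coe.1 hx)
    obtain ⟨b, hb, rfl⟩ := mem_image.1 (mem_coe.1 hy)
    simp only [hg a ha, hg b hb] at hxy
    rw [hxy]
  · intro x hx
    obtain ⟨a, ha, rfl⟩ := mem_image.1 hx
    rwa [hg a ha]

/-- The number of edges of the Turán graph on `n` vertices with `p` parts. -/
def turanNumber (p n : ℕ) : ℕ := ∑ i ∈ range n, (i - i / p)

lemma turanNumber_succ (p n : ℕ) : turanNumber p (n + 1) = turanNumber p n + (n - n / p) :=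
  sum_range_succ _ _

lemma turanNumber_of_le {p n : ℕ} (h : n ≤ p) : turanNumber p n = n.choose 2 := by
  rw [Nat.choose_two_right, ← sum_range_id]
  refine sum_congr rfl fun i hi => ?_
  rw [Nat.div_eq_of_lt (by have := mem_range.1 hi; omega), Nat.sub_zero]

/-- One vertex joins each part: every old vertex gains p - 1 neighbours, and the new ones form a
clique. -/
lemma turanNumber_add {p : ℕ} (hp : 0 < p) (n : ℕ) :
    turanNumber p (n + p) = turanNumber p n + n * (p - 1) + p.choose 2 := by
  induction n with
  | zero => rw [zero_add, turanNumber_of_le le_rfl]; simp [turanNumber]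
  | succ n ih =>
    have h1 : n / p ≤ n := Nat.div_le_self _ _
    rw [show n + 1 + p = (n + p) + 1 by omega, turanNumber_succ, turanNumber_succ, ih,
      Nat.add_div_right _ hp, add_mul]
    omega

/-- The Turán graph on p + 2 vertices misses just two edges, so the bound T + 1 only excludes a
fully rainbow clique. This is the base of the induction. -/
lemma turanNumber_add_two {p : ℕ} (hp : 2 ≤ p) :
    turanNumber p (p + 2) + 2 = (p + 2).choose 2 := by
  have h1 : (p + 2).choose 2 = (p + 1) + (p + p.choose 2) := by
    rw [Nat.choose_succ_succ' (p + 1) 1, Nat.choose_succ_succ' p 1, Nat.choose_one_right,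
      Nat.choose_one_right]
  rw [add_comm p 2, turanNumber_add (by omega), turanNumber_of_le hp, add_comm 2 p, h1,
    Nat.choose_self]
  omega

/-- Families of representatives as in `exists_representatives`. -/
structure IsRepresentation (f : Sym2 V → α) (U : Finset V) (R : V → Finset V) : Prop where
  subset : ∀ v, R v ⊆ U.erase v
  card_eq : ∀ v, (R v).card = (lostColors f U v).card
  injOn : ∀ v, Set.InjOn (fun x => f s(v, x)) (R v)
  mem_lost : ∀ v, ∀ x ∈ R v, f s(v, x) ∈ lostColors f U v

namespace IsRepresentation

variable {f : Sym2 V → α} {U : Finset V} {R : V → Finset V}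

lemma ne (hR : IsRepresentation f U R) {u v : V} (h : v ∈ R u) : v ≠ u :=
  (mem_erase.1 (hR.subset u h)).1

lemma mem (hR : IsRepresentation f U R) {u v : V} (h : v ∈ R u) : v ∈ U :=
  (mem_erase.1 (hR.subset u h)).2

/-- Arcs with a common tail are separated by `injOn`. For different tails a and x, a shared colour
is lost with both, so both edges contain a and x and coincide. -/
lemma eq_of_color_eq (hR : IsRepresentation f U R) {a b x y : V} (ha : a ∈ U) (hx : x ∈ U)
    (hb : b ∈ R a) (hy : y ∈ R x) (h : f s(a, b) = f s(x, y)) : s(a, b) = s(x, y) := by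
  by_cases hax : a = x
  · subst hax
    rw [hR.injOn a hb hy h]
  · have h1 := mem_of_color_mem_lostColors (h ▸ hR.mem_lost x y hy) ha (hR.mem hb) (hR.ne hb).symm
    have h2 := mem_of_color_mem_lostColors (h ▸ hR.mem_lost a b hb) hx (hR.mem hy) (hR.ne hy).symm
    obtain rfl : x = b := h1.resolve_left (Ne.symm hax)
    obtain rfl : a = y := h2.resolve_left hax
    exact Sym2.eq_swap

/-- A transitive tournament of representative edges together with one more vertex `w` that is
joined to it by representative edges, except for one edge that gets a colour of its own, forms a
rainbow clique. -/
lemma exists_rainbow (hR : IsRepresentation f U R) {l : List V}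
    (hl : l.Pairwise fun a b => b ∈ R a) (hlU : ∀ x ∈ l, x ∈ U) {v w : V} (hv : v ∈ l)
    (hw : w ∈ U) (hwl : w ∉ l) (hadj : ∀ x ∈ l, x ≠ v → w ∈ R x)
    (hcol : ∀ x ∈ l, x ∈ R v → f s(v, x) ≠ f s(v, w)) :
    ∃ X ⊆ U, X.card = l.length + 1 ∧ RainbowOn f X := by
  have hnd : l.Nodup := hl.imp fun h => (hR.ne h).symm
  refine ⟨insert w l.toFinset, ?_, ?_, ?_⟩
  · intro x hx
    rcases mem_insert.1 hx with rfl | hx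
    · exact hw
    · exact hlU x (List.mem_toFinset.1 hx)
  · rw [card_insert_of_notMem (by simpa using hwl), List.toFinset_card_of_nodup hnd]
  have hne : v ≠ w := fun h => hwl (h ▸ hv)
  have arcs : ∀ a ∈ l, ∀ b ∈ l, a ≠ b →
      ∃ x y, s(a, b) = s(x, y) ∧ x ∈ U ∧ y ∈ R x ∧ f s(x, y) ≠ f s(v, w) := by
    -- An arc with tail a ≠ v and the colour of vw would force a onto the edge vw; hence only arcs
    -- leaving v need `hcol`.
    have main : ∀ a ∈ l, ∀ b ∈ l, b ∈ R a → f s(a, b) ≠ f s(v, w) := by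
      intro a ha b hb hab hf
      by_cases hav : a = v
      · subst hav
        exact hcol b hb hab hf
      · rcases mem_of_color_mem_lostColors (hf ▸ hR.mem_lost a b hab) (hlU v hv) hw hne with h | h
        · exact hav h
        · exact hwl (h ▸ ha)
    intro a ha b hb hab
    have : Std.Symm fun a b => b ∈ R a ∨ a ∈ R b := ⟨fun _ _ h => h.symm⟩
    have := (hl.imp (S := fun a b => b ∈ R a ∨ a ∈ R b) Or.inl).forall ha hb hab
    rcases this with h | h
    · exact ⟨a, b, rfl, hlU a ha, h, main a ha b hb h⟩
    · exact ⟨b, a, Sym2.eq_swap, hlU b hb, h, main b hb a ha h⟩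
  have arcs' : ∀ a ∈ l, a ≠ v → f s(a, w) ≠ f s(v, w) := by
    intro a ha hav hf
    rcases mem_of_color_mem_lostColors (hf ▸ hR.mem_lost a w (hadj a ha hav)) (hlU v hv) hw hne
      with h | h
    · exact hav h
    · exact hwl (h ▸ ha)
  have all : ∀ e ∈ pairs (insert w l.toFinset), e = s(v, w) ∨
      ∃ x y, e = s(x, y) ∧ x ∈ U ∧ y ∈ R x ∧ f s(x, y) ≠ f s(v, w) := by
    intro e he
    induction e using Sym2.ind with
    | _ a b =>
      simp only [mk_mem_pairs, mem_insert, List.mem_toFinset] at he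
      obtain ⟨rfl | ha, rfl | hb, hab⟩ := he
      · exact absurd rfl hab
      · by_cases h : b = v
        · exact Or.inl (h ▸ Sym2.eq_swap)
        · exact Or.inr ⟨b, a, Sym2.eq_swap, hlU b hb, hadj b hb h, arcs' b hb h⟩
      · by_cases h : a = v
        · exact Or.inl (h ▸ rfl)
        · exact Or.inr ⟨a, b, rfl, hlU a ha, hadj a ha h, arcs' a ha h⟩
      · exact Or.inr (arcs a ha b hb hab)
  intro e he e' he' hee
  rcases all e he with rfl | ⟨x, y, rfl, hx, hy, hxy⟩ <;>
    rcases all e' he' with rfl | ⟨x', y', rfl, hx', hy', hxy'⟩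
  · rfl
  · exact absurd hee.symm hxy'
  · exact absurd hee hxy
  · exact hR.eq_of_color_eq hx hx' hy hy' hee

/-- If fewer than `|U|` vertices are missed, a transitive tournament extends. -/
lemma exists_extension {n p : ℕ} (hU : U.card = n + 1)
    (hcard : ∀ v ∈ U, (U \ R v).card ≤ n / p) {l : List V} (hlU : ∀ x ∈ l, x ∈ U)
    (hlen : l.length ≤ p) : ∃ z ∈ U, ∀ x ∈ l, z ∈ R x := by
  have h1 : (l.toFinset.biUnion fun x => U \ R x).card < U.card := by
    calc _ ≤ l.toFinset.card * (n / p) :=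
          card_biUnion_le_card_mul _ _ _ fun x hx => hcard x (hlU x (List.mem_toFinset.1 hx))
      _ ≤ p * (n / p) := Nat.mul_le_mul_right _ ((List.toFinset_card_le l).trans hlen)
      _ ≤ n := Nat.mul_div_le n p
      _ < _ := by omega
  obtain ⟨z, hz, hzn⟩ := exists_mem_notMem_of_card_lt_card h1
  refine ⟨z, hz, fun x hx => ?_⟩
  by_contra hzx
  exact hzn (mem_biUnion.2 ⟨x, List.mem_toFinset.2 hx, mem_sdiff.2 ⟨hz, hzx⟩⟩)

/-- In the absence of rainbow cliques of size `p + 2`, the sets missed by the vertices of a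
transitive tournament of size `p` are disjoint. -/
lemma disjoint_missed (hR : IsRepresentation f U R) {n p : ℕ} (hU : U.card = n + 1)
    (hcard : ∀ v ∈ U, (U \ R v).card ≤ n / p)
    (hfree : ∀ X ⊆ U, X.card = p + 2 → ¬ RainbowOn f X) {l : List V}
    (hl : l.Pairwise fun a b => b ∈ R a) (hlU : ∀ x ∈ l, x ∈ U) (hlen : l.length = p)
    {a b y : V} (ha : a ∈ l) (hb : b ∈ l) (hab : a ≠ b) (hy : y ∈ U) (hya : y ∉ R a) :
    y ∈ R b := by
  by_contra hyb
  obtain ⟨z, hz, hzl⟩ := exists_extension hU hcard hlU hlen.le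
  -- A vertex u ≠ z missed by nobody in l would complete l and z to a rainbow clique of size p + 2,
  -- with zu as the exceptional edge.
  have cover : ∀ u ∈ U, u ≠ z → ∃ x ∈ l, u ∉ R x := by
    intro u hu huz
    by_contra! hul
    have hul' : u ∉ l := fun h => hR.ne (hul u h) rfl
    have hzl' : z ∉ l := fun h => hR.ne (hzl z h) rfl
    obtain ⟨X, hXU, hX, hXf⟩ := hR.exists_rainbow (l := l ++ [z]) (v := z) (w := u)
      (List.pairwise_append.2 ⟨hl, List.pairwise_singleton _ _, by simpa using hzl⟩)
      (by simpa [or_imp, forall_and] using ⟨hlU, hz⟩) (by simp) hu (by simp [hul', huz])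
      (by
        intro x hx hxz
        simp only [List.mem_append, List.mem_singleton, hxz, or_false] at hx
        exact hul x hx)
      (by
        intro x hx hxz hf
        have hxz' := hR.ne hxz
        simp only [List.mem_append, List.mem_singleton, hxz', or_false] at hx
        have h := hR.mem_lost x z (hzl x hx)
        rw [Sym2.eq_swap, hf] at h
        rcases mem_of_color_mem_lostColors h hz hu huz.symm with h | h
        · exact hxz' h
        · exact hul' (h ▸ hx))
    exact hfree X hXU (by simp [hX, hlen]) hXf
  have hyz : y ≠ z := fun h => hya (h ▸ hzl a ha)
  -- The p missed sets, of size at most n / p each, cover the n vertices other than z. Since y is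
  -- counted twice, it can be dropped from the set of a, and the total falls below n.
  have hsub : U.erase z ⊆ (l.toFinset.erase a).biUnion (fun x => U \ R x) ∪ (U \ R a).erase y := by
    intro u hu
    obtain ⟨huz, huU⟩ := mem_erase.1 hu
    obtain ⟨x, hx, hux⟩ := cover u huU huz
    by_cases hxa : x = a
    · subst hxa
      by_cases huy : u = y
      · subst huy
        exact mem_union_left _ (mem_biUnion.2
          ⟨b, by simp [hab.symm, hb], mem_sdiff.2 ⟨huU, hyb⟩⟩)
      · exact mem_union_right _ (mem_erase.2 ⟨huy, mem_sdiff.2 ⟨huU, hux⟩⟩)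
    · exact mem_union_left _ (mem_biUnion.2 ⟨x, by simp [hxa, hx], mem_sdiff.2 ⟨huU, hux⟩⟩)
  have h1 := (card_le_card hsub).trans (card_union_le _ _)
  have h2 : ((l.toFinset.erase a).biUnion (fun x => U \ R x)).card ≤
      (l.toFinset.erase a).card * (n / p) :=
    card_biUnion_le_card_mul _ _ _ fun x hx => hcard x (hlU x (by simp at hx; exact hx.2))
  have hay : y ∈ U \ R a := mem_sdiff.2 ⟨hy, hya⟩
  have hnd : l.Nodup := hl.imp fun h => (hR.ne h).symm
  rw [card_erase_of_mem hz, hU, card_erase_of_mem hay] at h1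
  rw [card_erase_of_mem (by simpa using ha), List.toFinset_card_of_nodup hnd, hlen] at h2
  have h3 := hcard a (hlU a ha)
  have h4 : 0 < (U \ R a).card := card_pos.2 ⟨y, hay⟩
  have h5 : p * (n / p) ≤ n := Nat.mul_div_le n p
  have h6 : (p - 1) * (n / p) + n / p = p * (n / p) := by
    rw [← Nat.succ_mul, Nat.succ_eq_add_one, Nat.sub_add_cancel]
    have := List.length_pos_of_mem ha
    omega
  omega

end IsRepresentation

/-- **Anti-Ramsey theorem** for complete graphs: on at least `p + 2 ≥ 4` vertices, a colouring
without rainbow cliques of size `p + 2` has at most one colour more than the number of edges of the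
Turán graph with `p` parts. -/
theorem card_colors_le {f : Sym2 V → α} {p : ℕ} (hp : 2 ≤ p) (n : ℕ) (hn : p + 2 ≤ n)
    (U : Finset V) (hU : U.card = n) (hfree : ∀ X ⊆ U, X.card = p + 2 → ¬ RainbowOn f X) :
    (colors f U).card ≤ turanNumber p n + 1 := by
  induction n, hn using Nat.le_induction generalizing U with
  | base =>
    have h1 : (colors f U).card ≤ (p + 2).choose 2 := by
      rw [← hU, ← card_pairs]
      exact card_image_le
    have h2 : (colors f U).card ≠ (p + 2).choose 2 := by
      intro h
      rw [← hU, ← card_pairs] at h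
      exact hfree U subset_rfl hU (card_image_iff.1 h)
    have h3 := turanNumber_add_two hp
    omega
  | succ n hn ih =>
    by_contra! hlt
    rw [turanNumber_succ] at hlt
    have hnp : n / p ≤ n := Nat.div_le_self _ _
    -- Compare the assumed excess on n + 1 vertices with the induction hypothesis after deleting v.
    have hlost : ∀ v ∈ U, n - n / p + 1 ≤ (lostColors f U v).card := by
      intro v hv
      have h1 := ih (U.erase v) (by rw [card_erase_of_mem hv, hU]; rfl)
        fun X hX => hfree X (hX.trans (erase_subset _ _))
      have h2 := card_sdiff_add_card_eq_card (colors_mono f (erase_subset v U))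
      rw [lostColors]
      omega
    choose R hRU hRc hRi hRl using exists_representatives f U
    have hR : IsRepresentation f U R := ⟨hRU, hRc, hRi, hRl⟩
    have hcard : ∀ v ∈ U, (U \ R v).card ≤ n / p := by
      intro v hv
      have h1 := card_sdiff_add_card_eq_card ((hRU v).trans (erase_subset _ _))
      have h2 := hlost v hv
      rw [← hRc] at h2
      omega
    -- If each edge had its colour lost with both ends, every colour would determine its edge and U
    -- would be rainbow.
    obtain ⟨v, hv, w, hw, hvw, hnl⟩ :
        ∃ v ∈ U, ∃ w ∈ U, v ≠ w ∧ f s(v, w) ∉ lostColors f U v := by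
      by_contra! hall
      obtain ⟨X, hXU, hX⟩ := exists_subset_card_eq (show p + 2 ≤ U.card by omega)
      refine hfree X hXU hX (RainbowOn.mono ?_ hXU)
      intro e he e' he' hee
      induction e using Sym2.ind with
      | _ a b =>
        induction e' using Sym2.ind with
        | _ x y =>
          obtain ⟨ha, hb, hab⟩ := mk_mem_pairs.1 he
          obtain ⟨hx, hy, hxy⟩ := mk_mem_pairs.1 he'
          have h1 := hall a ha b hb hab
          have h2 := hall b hb a ha hab.symm
          rw [hee] at h1
          rw [Sym2.eq_swap, hee] at h2
          have h3 := mem_of_color_mem_lostColors h1 hx hy hxy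
          have h4 := mem_of_color_mem_lostColors h2 hx hy hxy
          grind
    have build : ∀ m, m + 1 ≤ p → ∃ l : List V, l.length = m + 1 ∧ v ∈ l ∧
        (l.Pairwise fun a b => b ∈ R a) ∧ ∀ x ∈ l, x ∈ U := by
      intro m
      induction m with
      | zero => exact fun _ => ⟨[v], by simp [hv]⟩
      | succ m ihm =>
        intro hm
        obtain ⟨l, hlen, hvl, hl, hlU⟩ := ihm (by omega)
        obtain ⟨z, hz, hzl⟩ := IsRepresentation.exists_extension hU hcard hlU (by omega)
        refine ⟨l ++ [z], by simp [hlen], by simp [hvl], ?_, ?_⟩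
        · exact List.pairwise_append.2 ⟨hl, List.pairwise_singleton _ _, by simpa using hzl⟩
        · simpa [or_imp, forall_and] using ⟨hlU, hz⟩
    -- The list has p - 1 vertices, so that y and z each complete it to a tournament of the size p
    -- required by `disjoint_missed`.
    obtain ⟨l, hlen, hvl, hl, hlU⟩ := build (p - 2) (by omega)
    have extend : ∀ z ∈ U, (∀ x ∈ l, z ∈ R x) →
        ((l ++ [z]).Pairwise fun a b => b ∈ R a) ∧ (∀ x ∈ l ++ [z], x ∈ U) ∧
          (l ++ [z]).length = p := by
      intro z hz hzl
      refine ⟨List.pairwise_append.2 ⟨hl, List.pairwise_singleton _ _, by simpa using hzl⟩, ?_, ?_⟩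
      · simpa [or_imp, forall_and] using ⟨hlU, hz⟩
      · simp [hlen]; omega
    obtain ⟨y, hy, hyl⟩ := IsRepresentation.exists_extension hU hcard hlU (by omega)
    obtain ⟨hl1, hlU1, hlen1⟩ := extend y hy hyl
    obtain ⟨z, hz, hzl⟩ := IsRepresentation.exists_extension hU hcard hlU1 hlen1.le
    obtain ⟨hl2, hlU2, hlen2⟩ := extend z hz fun x hx => hzl x (by simp [hx])
    have hwv : w ∉ R v := fun h => hnl (hR.mem_lost v w h)
    -- As v misses w, no other vertex of either p-tournament misses it; together they cover l, y and
    -- z. Adding w to these p + 1 vertices gives the rainbow clique, with vw as the exceptional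
    -- edge.
    have hwadj : ∀ x ∈ (l ++ [y]) ++ [z], x ≠ v → w ∈ R x := by
      intro x hx hxv
      have hx' : x ∈ l ++ [y] ∨ x ∈ l ++ [z] := by
        simp only [List.mem_append] at hx ⊢; tauto
      rcases hx' with hx | hx
      · exact hR.disjoint_missed hU hcard hfree hl1 hlU1 hlen1 (by simp [hvl]) hx hxv.symm hw hwv
      · exact hR.disjoint_missed hU hcard hfree hl2 hlU2 hlen2 (by simp [hvl]) hx hxv.symm hw hwv
    obtain ⟨X, hXU, hX, hXf⟩ := hR.exists_rainbow (l := (l ++ [y]) ++ [z]) (v := v) (w := w)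
      (List.pairwise_append.2 ⟨hl1, List.pairwise_singleton _ _, by simpa using hzl⟩)
      (by
        intro x hx
        rcases List.mem_append.1 hx with hx | hx
        · exact hlU1 x hx
        · rwa [List.mem_singleton.1 hx])
      (by simp [hvl]) hw (fun h => hR.ne (hwadj w h hvw.symm) rfl) hwadj
      (fun x _ hxv hf => hnl (hf ▸ hR.mem_lost v x hxv))
    refine hfree X hXU ?_ hXf
    rw [hX, List.length_append, hlen1]
    rfl

end Rainbow

end AntiRamsey

namespace AntiRamsey

open SimpleGraph Finset

/-! ### Extremal graphs whose (p + 2)-sets all miss two edges -/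

section NearClique

lemma card_edgeFinset_turanGraph_eq {p : ℕ} (hp : 0 < p) (n : ℕ) :
    (turanGraph n p).edgeFinset.card = turanNumber p n := by
  induction n using Nat.strong_induction_on with
  | _ n ih =>
    by_cases h : n ≤ p
    · have := card_edgeFinset_top_eq_card_choose_two (V := Fin n)
      rw [Fintype.card_fin] at this
      rw [turanNumber_of_le h, ← this]
      congr!
      exact turanGraph_eq_top.2 (Or.inr h)
    · obtain ⟨m, rfl⟩ := Nat.exists_eq_add_of_le' (not_le.1 h).le
      rw [card_edgeFinset_turanGraph_add, turanNumber_add hp, ih m (by omega)]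

/-- All pairs in `X` except possibly one are adjacent in `G`. -/
def IsNearClique {V : Type*} (G : SimpleGraph V) (X : Finset V) : Prop :=
  ∃ e₀ : Sym2 V, ∀ a ∈ X, ∀ b ∈ X, a ≠ b → s(a, b) ≠ e₀ → G.Adj a b

lemma nonempty_iso_of_labelling {V : Type*} [Fintype V] {G : SimpleGraph V} {m : ℕ} (hm : Fintype.card V = m) {H : SimpleGraph (Fin m)}
    (g : Fin m → V) (hg : Function.Injective g)
    (h : ∀ i j, i < j → (G.Adj (g i) (g j) ↔ H.Adj i j)) : Nonempty (G ≃g H) := by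
  have hbij : Function.Bijective g :=
    (Fintype.bijective_iff_injective_and_card g).2 ⟨hg, by rw [hm, Fintype.card_fin]⟩
  refine ⟨(RelIso.symm ⟨Equiv.ofBijective g hbij, ?_⟩ : G ≃g H)⟩
  intro i j
  change G.Adj (g i) (g j) ↔ H.Adj i j
  rcases lt_trichotomy i j with hij | rfl | hij
  · exact h i j hij
  · simp
  · rw [G.adj_comm, H.adj_comm, h j i hij]

/-- The two outer vertices attach either to the same vertex of the triangle (hourglass) or to
different ones (house). -/
lemma iso_of_card_eq_five {V : Type*} [Fintype V] [DecidableEq V] {G : SimpleGraph V}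
    (hV : Fintype.card V = 5) {X : Finset V} (hX : G.IsNClique 3 X)
    (hY : G.IsClique (Xᶜ : Finset V))
    (hXY : ∀ y ∉ X, ∃ x ∈ X, G.Adj y x ∧ ∀ z ∈ X, G.Adj y z → z = x) :
    Nonempty (G ≃g hourglass) ∨ Nonempty (G ≃g house) := by
  have hYc : Xᶜ.card = 2 := by rw [card_compl, hV, hX.card_eq]
  obtain ⟨y₁, y₂, hy, hYe⟩ := card_eq_two.1 hYc
  have hy₁ : y₁ ∉ X := by rw [← mem_compl, hYe]; simp
  have hy₂ : y₂ ∉ X := by rw [← mem_compl, hYe]; simp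
  have hyy : G.Adj y₁ y₂ := hY (by simp [hYe]) (by simp [hYe]) hy
  obtain ⟨x₁, hx₁, h₁, hu₁⟩ := hXY y₁ hy₁
  obtain ⟨x₂, hx₂, h₂, hu₂⟩ := hXY y₂ hy₂
  by_cases hx : x₁ = x₂
  · subst hx
    left
    have : (X.erase x₁).card = 2 := by rw [card_erase_of_mem hx₁, hX.card_eq]
    obtain ⟨b, c, hbc, hbce⟩ := card_eq_two.1 this
    obtain ⟨hbx, hb⟩ := mem_erase.1 (show b ∈ X.erase x₁ by simp [hbce])
    obtain ⟨hcx, hc⟩ := mem_erase.1 (show c ∈ X.erase x₁ by simp [hbce])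
    have hab := hX.isClique hb hc hbc
    have hax := hX.isClique hb hx₁ hbx
    have hcx' := hX.isClique hc hx₁ hcx
    have n1 : ¬ G.Adj b y₁ := fun h => hbx (hu₁ b hb h.symm)
    have n2 : ¬ G.Adj c y₁ := fun h => hcx (hu₁ c hc h.symm)
    have n3 : ¬ G.Adj b y₂ := fun h => hbx (hu₂ b hb h.symm)
    have n4 : ¬ G.Adj c y₂ := fun h => hcx (hu₂ c hc h.symm)
    refine nonempty_iso_of_labelling hV ![b, c, x₁, y₁, y₂] ?_ ?_
    · intro i j
      fin_cases i <;> fin_cases j <;> simp <;> grind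
    · intro i j
      fin_cases i <;> fin_cases j <;>
        simp [hourglass, hab, hax, hcx', n1, n2, n3, n4, h₁.symm, h₂.symm, hyy]
  · right
    have : ((X.erase x₁).erase x₂).card = 1 := by
      rw [card_erase_of_mem (mem_erase.2 ⟨Ne.symm hx, hx₂⟩), card_erase_of_mem hx₁, hX.card_eq]
    obtain ⟨b, hbe⟩ := card_eq_one.1 this
    have hb' : b ∈ (X.erase x₁).erase x₂ := by simp [hbe]
    obtain ⟨hb2, hb1, hb⟩ : b ≠ x₂ ∧ b ≠ x₁ ∧ b ∈ X := by simpa using hb'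
    have a1 := hX.isClique hx₁ hb hb1.symm
    have a2 := hX.isClique hx₂ hb hb2.symm
    have a3 := hX.isClique hx₁ hx₂ hx
    have n1 : ¬ G.Adj y₁ b := fun h => hb1 (hu₁ b hb h)
    have n2 : ¬ G.Adj y₂ b := fun h => hb2 (hu₂ b hb h)
    have n3 : ¬ G.Adj y₁ x₂ := fun h => hx (hu₁ _ hx₂ h).symm
    have n4 : ¬ G.Adj y₂ x₁ := fun h => hx (hu₂ _ hx₁ h)
    refine nonempty_iso_of_labelling hV ![y₂, y₁, x₁, x₂, b] ?_ ?_
    · intro i j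
      fin_cases i <;> fin_cases j <;> simp <;> grind
    · intro i j
      fin_cases i <;> fin_cases j <;>
        simp [house, a1, a2, a3, n1, n2, n3, n4, h₁, h₂, hyy.symm]

/-- Uniqueness from both sides makes the edges between the two triangles a perfect matching. -/
lemma iso_of_card_eq_six {V : Type*} [Fintype V] [DecidableEq V] {G : SimpleGraph V}
    (hV : Fintype.card V = 6) {X : Finset V} (hX : G.IsNClique 3 X)
    (hY : G.IsClique (Xᶜ : Finset V))
    (hXY : ∀ y ∉ X, ∃ x ∈ X, G.Adj y x ∧ ∀ z ∈ X, G.Adj y z → z = x)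
    (hYX : ∀ x ∈ X, ∃ y ∉ X, G.Adj x y ∧ ∀ z ∉ X, G.Adj x z → z = y) :
    Nonempty (G ≃g prism) := by
  obtain ⟨x₁, x₂, x₃, h12, h13, h23, hXe⟩ := card_eq_three.1 hX.card_eq
  have hx₁ : x₁ ∈ X := by simp [hXe]
  have hx₂ : x₂ ∈ X := by simp [hXe]
  have hx₃ : x₃ ∈ X := by simp [hXe]
  obtain ⟨y₁, hy₁, a₁, hu₁⟩ := hYX x₁ hx₁
  obtain ⟨y₂, hy₂, a₂, hu₂⟩ := hYX x₂ hx₂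
  obtain ⟨y₃, hy₃, a₃, hu₃⟩ := hYX x₃ hx₃
  have huniq : ∀ y ∉ X, ∀ x ∈ X, ∀ x' ∈ X, G.Adj x y → G.Adj x' y → x = x' := by
    intro y hy x hx x' hx' h h'
    obtain ⟨z, -, -, hz⟩ := hXY y hy
    rw [hz x hx h.symm, hz x' hx' h'.symm]
  have e12 : y₁ ≠ y₂ := fun h => h12 (huniq y₁ hy₁ _ hx₁ _ hx₂ a₁ (h ▸ a₂))
  have e13 : y₁ ≠ y₃ := fun h => h13 (huniq y₁ hy₁ _ hx₁ _ hx₃ a₁ (h ▸ a₃))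
  have e23 : y₂ ≠ y₃ := fun h => h23 (huniq y₂ hy₂ _ hx₂ _ hx₃ a₂ (h ▸ a₃))
  have b12 := hX.isClique hx₁ hx₂ h12
  have b13 := hX.isClique hx₁ hx₃ h13
  have b23 := hX.isClique hx₂ hx₃ h23
  have c12 : G.Adj y₁ y₂ := hY (by simpa using hy₁) (by simpa using hy₂) e12
  have c13 : G.Adj y₁ y₃ := hY (by simpa using hy₁) (by simpa using hy₃) e13
  have c23 : G.Adj y₂ y₃ := hY (by simpa using hy₂) (by simpa using hy₃) e23
  have n12 : ¬ G.Adj x₁ y₂ := fun h => e12 (hu₁ _ hy₂ h).symm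
  have n13 : ¬ G.Adj x₁ y₃ := fun h => e13 (hu₁ _ hy₃ h).symm
  have n21 : ¬ G.Adj x₂ y₁ := fun h => e12 (hu₂ _ hy₁ h)
  have n23 : ¬ G.Adj x₂ y₃ := fun h => e23 (hu₂ _ hy₃ h).symm
  have n31 : ¬ G.Adj x₃ y₁ := fun h => e13 (hu₃ _ hy₁ h)
  have n32 : ¬ G.Adj x₃ y₂ := fun h => e23 (hu₃ _ hy₂ h)
  refine nonempty_iso_of_labelling hV ![x₁, x₂, x₃, y₁, y₂, y₃] ?_ ?_
  · intro i j
    fin_cases i <;> fin_cases j <;> simp <;> grind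
  · intro i j
    fin_cases i <;> fin_cases j <;>
      simp [prism, a₁, a₂, a₃, b12, b13, b23, c12, c13, c23, n12, n13, n21, n23, n31, n32]

variable {V : Type*} (G : SimpleGraph V) [DecidableRel G.Adj]

/-- The number of pairs in `S × T` that are adjacent in `G`. -/
def adjCount (S T : Finset V) : ℕ := ∑ a ∈ S, ∑ b ∈ T, if G.Adj a b then 1 else 0

lemma adjCount_univ [Fintype V] : adjCount G univ univ = 2 * G.edgeFinset.card := by
  rw [← sum_degrees_eq_twice_card_edges, adjCount]
  refine sum_congr rfl fun a _ => ?_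
  rw [← card_neighborFinset_eq_degree, neighborFinset_eq_filter, card_filter]

lemma adjCount_comm (S T : Finset V) : adjCount G S T = adjCount G T S := by
  rw [adjCount, adjCount, sum_comm]
  simp_rw [G.adj_comm]

lemma adjCount_self (Y : Finset V) :
    adjCount G Y Y = 2 * (G.comap (Subtype.val : Y → V)).edgeFinset.card := by
  rw [← adjCount_univ, adjCount, adjCount, ← sum_coe_sort]
  refine sum_congr rfl fun a _ => ?_
  rw [← sum_coe_sort]
  rfl

variable {G}

lemma adjCount_self_le_choose (Y : Finset V) : adjCount G Y Y ≤ 2 * Y.card.choose 2 := by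
  rw [adjCount_self]
  have := (G.comap (Subtype.val : Y → V)).card_edgeFinset_le_card_choose_two
  rw [Fintype.card_coe] at this
  omega

variable [DecidableEq V]

/-- With p neighbours in X, the vertex y would miss at most one vertex of the clique, leaving a near
clique of size p + 2. -/
lemma adjCount_le_of_isNClique {p : ℕ} (hp : 2 ≤ p)
    (hG : ∀ X : Finset V, X.card = p + 2 → ¬ IsNearClique G X) {X : Finset V}
    (hX : G.IsNClique (p + 1) X) {y : V} (hy : y ∉ X) :
    (∑ x ∈ X, if G.Adj y x then 1 else 0) ≤ p - 1 := by
  rw [← card_filter]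
  by_contra! hlt
  refine hG (insert y X) (by rw [card_insert_of_notMem hy, hX.card_eq]) ?_
  have h1 := card_filter_add_card_filter_not (s := X) (fun x => G.Adj y x)
  rw [hX.card_eq] at h1
  have h2 : (X.filter fun x => ¬ G.Adj y x).card ≤ 1 := by omega
  have hmem : ∀ x ∈ X, ¬ G.Adj y x → x ∈ X.filter fun x => ¬ G.Adj y x := fun x hx hn =>
    mem_filter.2 ⟨hx, hn⟩
  obtain ⟨z, hz⟩ : ∃ z, ∀ x ∈ X, x ≠ z → G.Adj y x := by
    rcases (X.filter fun x => ¬ G.Adj y x).eq_empty_or_nonempty with h | ⟨z, hz⟩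
    · exact ⟨y, fun x hx _ => by_contra fun hn => notMem_empty x (h ▸ hmem x hx hn)⟩
    · exact ⟨z, fun x hx hxz => by_contra fun hn =>
        hxz (card_le_one.1 h2 _ (hmem x hx hn) _ hz)⟩
  refine ⟨s(y, z), fun a ha b hb hab hne => ?_⟩
  rcases mem_insert.1 ha with ha' | ha' <;> rcases mem_insert.1 hb with hb' | hb'
  · exact absurd (ha'.trans hb'.symm) hab
  · subst ha'
    exact hz b hb' (fun h => hne (h ▸ rfl))
  · subst hb'
    exact (hz a ha' (fun h => hne (h ▸ Sym2.eq_swap))).symm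
  · exact hX.isClique ha' hb' hab

lemma adjCount_univ_eq [Fintype V] (G : SimpleGraph V) [DecidableRel G.Adj] (X : Finset V) : adjCount G univ univ =
    adjCount G X X + 2 * adjCount G Xᶜ X + adjCount G Xᶜ Xᶜ := by
  have h : adjCount G univ univ =
      adjCount G X X + adjCount G X Xᶜ + (adjCount G Xᶜ X + adjCount G Xᶜ Xᶜ) := by
    simp only [adjCount, ← sum_add_distrib, sum_add_sum_compl]
  rw [h, adjCount_comm G X Xᶜ]
  ring

/-- A graph in which every set of `p + 2 ≥ 4` vertices misses at least two edges has at most as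
many edges as the Turán graph with `p` parts. -/
lemma card_edgeFinset_le_turanNumber [Fintype V] {p : ℕ} (hp : 2 ≤ p) (hn : p + 2 ≤ Fintype.card V)
    (hG : ∀ X : Finset V, X.card = p + 2 → ¬ IsNearClique G X) :
    G.edgeFinset.card ≤ turanNumber p (Fintype.card V) := by
  -- Each edge of G is its own colour and all non-edges share `none`; a rainbow set then contains at
  -- most one non-edge.
  let f : Sym2 V → Option (Sym2 V) := fun e => if e ∈ G.edgeFinset then some e else none
  have h1 : (colors f univ).card ≤ turanNumber p (Fintype.card V) + 1 := by
    refine card_colors_le hp _ hn univ card_univ fun X _ hX hXf => hG X hX ?_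
    by_cases h : ∃ e ∈ pairs X, e ∉ G.edgeFinset
    · obtain ⟨e, he, heG⟩ := h
      refine ⟨e, fun a ha b hb hab hne => ?_⟩
      by_contra hadj
      refine hne (hXf (mk_mem_pairs.2 ⟨ha, hb, hab⟩) he ?_)
      simp only [f, heG, if_false]
      rw [if_neg (by simpa using hadj)]
    · push Not at h
      obtain ⟨x, hx⟩ : X.Nonempty := card_pos.1 (by omega)
      refine ⟨s(x, x), fun a ha b hb hab _ => ?_⟩
      simpa using h _ (mk_mem_pairs.2 ⟨ha, hb, hab⟩)
  have h2 : insert none (G.edgeFinset.image some) ⊆ colors f univ := by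
    intro o ho
    rcases mem_insert.1 ho with rfl | ho
    · obtain ⟨X, -, hX⟩ := exists_subset_card_eq (s := (univ : Finset V)) (n := p + 2) hn
      obtain ⟨x, hx⟩ : X.Nonempty := card_pos.1 (by omega)
      have := hG X hX
      simp only [IsNearClique, not_exists, not_forall] at this
      obtain ⟨a, -, b, -, hab, -, hadj⟩ := this s(x, x)
      exact mem_colors.2 ⟨a, mem_univ _, b, mem_univ _, hab, if_neg (by simpa using hadj)⟩
    · obtain ⟨e, he, rfl⟩ := mem_image.1 ho
      induction e using Sym2.ind with
      | _ a b =>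
        have hab : G.Adj a b := by simpa using he
        exact mem_colors.2 ⟨a, mem_univ _, b, mem_univ _, hab.ne, if_pos he⟩
  have h3 := card_le_card h2
  rw [card_insert_of_notMem (by simp), card_image_of_injective _ (Option.some_injective _)] at h3
  omega

/-- The correction term is for p + 1 vertices, where the complete graph is allowed and has one edge
more than the Turán graph. The factor 2 comes from counting ordered pairs. -/
lemma adjCount_self_le {p : ℕ} (hp : 2 ≤ p)
    (hG : ∀ X : Finset V, X.card = p + 2 → ¬ IsNearClique G X) (Y : Finset V) :
    adjCount G Y Y ≤ 2 * (turanNumber p Y.card + if Y.card = p + 1 then 1 else 0) := by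
  by_cases h : p + 2 ≤ Y.card
  · rw [adjCount_self, if_neg (by omega)]
    have := card_edgeFinset_le_turanNumber (G := G.comap (Subtype.val : Y → V)) hp
      (by rwa [Fintype.card_coe]) (by
        rintro X hX ⟨e₀, he₀⟩
        refine hG (X.map (Function.Embedding.subtype _)) (by rw [card_map, hX])
          ⟨e₀.map Subtype.val, ?_⟩
        simp only [mem_map, Function.Embedding.coe_subtype]
        rintro _ ⟨a, ha, rfl⟩ _ ⟨b, hb, rfl⟩ hab hne
        refine he₀ a ha b hb (fun h => hab (h ▸ rfl)) ?_
        rintro rfl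
        exact hne rfl)
    rw [Fintype.card_coe] at this
    omega
  · have h1 := adjCount_self_le_choose (G := G) Y
    by_cases h2 : Y.card = p + 1
    · have h3 := turanNumber_succ p p
      rw [turanNumber_of_le le_rfl, Nat.div_self (by omega)] at h3
      have h4 : (p + 1).choose 2 = p + p.choose 2 := by
        rw [Nat.choose_succ_succ' p 1, Nat.choose_one_right]
      rw [if_pos h2]
      rw [h2] at h1 ⊢
      omega
    · rw [turanNumber_of_le (by omega), if_neg h2]
      omega

variable [Fintype V]

/-- The extremal graphs that contain a clique of size `p + 1`. -/
lemma structure_of_isNClique {p : ℕ} (hp : 2 ≤ p) (hn : p + 3 ≤ Fintype.card V)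
    (hG : ∀ X : Finset V, X.card = p + 2 → ¬ IsNearClique G X)
    (hE : G.edgeFinset.card = turanNumber p (Fintype.card V)) {X : Finset V}
    (hX : G.IsNClique (p + 1) X) :
    p = 2 ∧ (Fintype.card V = 5 ∨ Fintype.card V = 6) ∧ G.IsClique (Xᶜ : Finset V) ∧
      ∀ y ∉ X, ∃ x ∈ X, G.Adj y x ∧ ∀ z ∈ X, G.Adj y z → z = x := by
  have hsplit := adjCount_univ_eq G X
  rw [adjCount_univ, hE] at hsplit
  have hXX := adjCount_self_le_choose (G := G) X
  have hYY := adjCount_self_le hp hG Xᶜ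
  have hdeg : ∀ y ∈ Xᶜ, (∑ x ∈ X, if G.Adj y x then 1 else 0) ≤ p - 1 := fun y hy =>
    adjCount_le_of_isNClique hp hG hX (mem_compl.1 hy)
  have hYX : adjCount G Xᶜ X ≤ Xᶜ.card * (p - 1) := by
    rw [← smul_eq_mul, ← sum_const]
    exact sum_le_sum hdeg
  have hcard := card_compl X
  rw [hX.card_eq] at hXX hcard
  generalize hq : Xᶜ.card = q at *
  have hnq : Fintype.card V = (q + 1) + p := by omega
  have h4 : (p + 1).choose 2 = p + p.choose 2 := by
    rw [Nat.choose_succ_succ' p 1, Nat.choose_one_right]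
  rw [hnq, turanNumber_add (by omega), turanNumber_succ, add_mul, one_mul] at hsplit
  rw [h4] at hXX
  have hdiv : q / p ≤ q / 2 := Nat.div_le_div_left hp (by omega)
  -- Peeling p vertices off the Turán graph and cancelling common terms compares q - q / p + (p - 1)
  -- with p plus the correction.
  have hfin : q - q / p ≤ 1 + if q = p + 1 then 1 else 0 := by omega
  have hp2 : p = 2 := by
    split_ifs at hfin with h
    · have : q / p = 1 := by
        rw [h, Nat.add_div_left _ (by omega), Nat.div_eq_of_lt (by omega)]
      omega
    · by_contra hp2
      rw [Nat.div_eq_of_lt (by omega : q < p)] at hfin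
      omega
  subst hp2
  have hq23 : q = 2 ∨ q = 3 := by split_ifs at hfin <;> omega
  -- For p = 2 and q = 2 or 3 all the estimates are equalities: Y = Xᶜ is a clique, and each of its
  -- vertices has exactly one neighbour in X.
  have hYX' : adjCount G Xᶜ X = q := by
    rcases hq23 with rfl | rfl <;> simp at hYY hYX hsplit hXX ⊢ <;> omega
  have hYY' : adjCount G Xᶜ Xᶜ = q * q - q := by
    rcases hq23 with rfl | rfl
    · rw [turanNumber_of_le le_rfl] at hYY hsplit
      simp at hYY hYX hsplit hXX ⊢
      omega
    · rw [turanNumber_succ, turanNumber_of_le le_rfl] at hYY hsplit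
      simp at hYY hYX hsplit hXX ⊢
      omega
  refine ⟨rfl, by omega, ?_, ?_⟩
  · have h1 : adjCount G Xᶜ Xᶜ = ∑ a ∈ Xᶜ, ∑ b ∈ Xᶜ, if a ≠ b then 1 else 0 := by
      have hin : ∀ a ∈ Xᶜ, (∑ b ∈ Xᶜ, if a ≠ b then 1 else 0) = q - 1 := fun a ha => by
        rw [← card_filter, filter_ne, card_erase_of_mem ha, hq]
      rw [hYY', sum_congr rfl hin, sum_const, hq, smul_eq_mul, Nat.mul_sub_one]
    have hle : ∀ a b, (if G.Adj a b then 1 else 0) ≤ if a ≠ b then 1 else 0 := by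
      intro a b
      by_cases h : G.Adj a b
      · simp [h, h.ne]
      · simp [h]
    intro a ha b hb hab
    have h2 := (sum_eq_sum_iff_of_le fun a _ => sum_le_sum fun b _ => hle a b).1 h1 a ha
    have h3 := (sum_eq_sum_iff_of_le fun b _ => hle a b).1 h2 b hb
    by_contra hadj
    simp [hadj, hab] at h3
  · have h1 : (∑ y ∈ Xᶜ, ∑ x ∈ X, if G.Adj y x then 1 else 0) = ∑ y ∈ Xᶜ, 1 := by
      rw [sum_const, hq, smul_eq_mul, mul_one]
      exact hYX'
    intro y hy
    have h2 := (sum_eq_sum_iff_of_le hdeg).1 h1 y (mem_compl.2 hy)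
    rw [← card_filter] at h2
    obtain ⟨x, hx⟩ := card_eq_one.1 h2
    have hx' : ∀ z, z ∈ X ∧ G.Adj y z ↔ z = x := fun z => by
      rw [← mem_filter, hx, mem_singleton]
    exact ⟨x, ((hx' x).2 rfl).1, ((hx' x).2 rfl).2, fun z hz hyz => (hx' z).1 ⟨hz, hyz⟩⟩

/-- The graphs with the Turán number of edges in which every set of `p + 2` vertices misses at
least two edges. -/
theorem iso_of_card_edgeFinset_eq {p : ℕ} (hp : 2 ≤ p) (hn : p + 3 ≤ Fintype.card V)
    (hG : ∀ X : Finset V, X.card = p + 2 → ¬ IsNearClique G X)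
    (hE : G.edgeFinset.card = turanNumber p (Fintype.card V)) :
    (p = 2 ∧ Fintype.card V = 5 ∧ (Nonempty (G ≃g hourglass) ∨ Nonempty (G ≃g house))) ∨
    (p = 2 ∧ Fintype.card V = 6 ∧ Nonempty (G ≃g prism)) ∨
    Nonempty (G ≃g turanGraph (Fintype.card V) p) := by
  by_cases hfree : G.CliqueFree (p + 1)
  · right; right
    refine (isTuranMaximal_iff_nonempty_iso_turanGraph (by omega)).1 ⟨hfree, ?_⟩
    intro H _ hH
    have := hH.card_edgeFinset_le
    rw [hE, ← card_edgeFinset_turanGraph_eq (by omega), card_edgeFinset_turanGraph]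
    exact this
  · obtain ⟨X, hX⟩ : ∃ X, G.IsNClique (p + 1) X := by simpa [CliqueFree] using hfree
    obtain ⟨rfl, h5 | h6, hY, hXY⟩ := structure_of_isNClique hp hn hG hE hX
    · exact Or.inl ⟨rfl, h5, iso_of_card_eq_five h5 hX hY hXY⟩
    -- On six vertices the complement of X is a triangle too, so the structure applies with the
    -- roles exchanged.
    · have hX' : G.IsNClique 3 Xᶜ := ⟨hY, by rw [card_compl, h6, hX.card_eq]⟩
      obtain ⟨-, -, -, hYX⟩ := structure_of_isNClique hp hn hG hE hX'
      refine Or.inr (Or.inl ⟨rfl, h6, iso_of_card_eq_six h6 hX hY hXY fun x hx => ?_⟩)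
      obtain ⟨y, hy, h1, h2⟩ := hYX x (by simpa using hx)
      exact ⟨y, by simpa using hy, h1, fun z hz => h2 z (by simpa using hz)⟩

end NearClique

end AntiRamsey

namespace AntiRamsey

open SimpleGraph Finset

/-! ### Colour classes, refinement and extremality -/

section Coloring

lemma mem_saturated {V α : Type*} {G : SimpleGraph V} {c : EdgeLabeling G α} {v : V} {a : α} :
    a ∈ saturated c v ↔ (∃ w, ∃ h : G.Adj v w, c.get v w h = a) ∧
      ∀ x y (h : G.Adj x y), c.get x y h = a → v = x ∨ v = y := by
  constructor
  · rintro ⟨⟨⟨e, he⟩, hv, hc⟩, hall⟩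
    refine ⟨?_, fun x y h hxy => by simpa using hall ⟨s(x, y), h⟩ hxy⟩
    obtain ⟨w, rfl⟩ := Sym2.mem_iff_exists.1 hv
    exact ⟨w, he, hc⟩
  · rintro ⟨⟨w, h, hc⟩, hall⟩
    refine ⟨⟨⟨s(v, w), h⟩, Sym2.mem_mk_left v w, hc⟩, ?_⟩
    rintro ⟨e, he⟩ hec
    induction e using Sym2.ind with
    | _ x y => simpa using hall x y he hec

lemma rainbowFree_completeGraph_iff {V α : Type*} {G : SimpleGraph V} {k : ℕ}
    {c : EdgeLabeling G α} : RainbowFree (completeGraph (Fin k)) c ↔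
      ∀ (g : Fin k → V) (hg : ∀ i j, i ≠ j → G.Adj (g i) (g j)),
        ¬ ∀ i j i' j' (h : i ≠ j) (h' : i' ≠ j'),
          c.get (g i) (g j) (hg i j h) = c.get (g i') (g j') (hg i' j' h') →
            s(i, j) = s(i', j') := by
  constructor
  · intro hfree g hg hinj
    refine hfree ⟨⟨g, fun {i j} h => hg i j h⟩, fun i j hij => ?_⟩ ?_
    · by_contra hne
      exact (hg i j hne).ne hij
    · rintro ⟨e, he⟩ ⟨e', he'⟩ hee
      induction e using Sym2.ind with
      | _ i j =>
        induction e' using Sym2.ind with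
        | _ i' j' => exact Subtype.ext (hinj i j i' j' he he' hee)
  · intro hfree φ hinj
    refine hfree φ (fun i j hij => φ.toHom.map_adj hij) fun i j i' j' h h' hc => ?_
    exact congrArg Subtype.val (@hinj ⟨s(i, j), h⟩ ⟨s(i', j'), h'⟩ hc)

/-- Colourings with the same colour classes are isomorphic. -/
lemma isColoredIso_of_forall_iff {V W α β : Type*} {G : SimpleGraph V} {G' : SimpleGraph W}
    {c : EdgeLabeling G α} {c' : EdgeLabeling G' β} {ρ : G ≃g G'}
    (h : ∀ e e', c e = c e' ↔ c' (ρ.mapEdgeSet e) = c' (ρ.mapEdgeSet e')) :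
    IsColoredIso c c' ρ := by
  have hsurj : ∀ a : Set.range c, ∃ e, c e = a := fun a => a.2
  choose g hg using hsurj
  have hcg : ∀ e, c' (ρ.mapEdgeSet (g ⟨c e, Set.mem_range_self e⟩)) = c' (ρ.mapEdgeSet e) :=
    fun e => (h _ _).1 (hg _)
  refine ⟨Equiv.ofBijective
    (fun a => ⟨c' (ρ.mapEdgeSet (g a)), Set.mem_range_self _⟩) ⟨?_, ?_⟩, hcg⟩
  · intro a b hab
    have := (h _ _).2 (congrArg Subtype.val hab)
    rw [hg, hg] at this
    exact Subtype.ext this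
  · rintro ⟨_, e, rfl⟩
    obtain ⟨e, rfl⟩ := ρ.mapEdgeSet.surjective e
    exact ⟨⟨c e, Set.mem_range_self e⟩, Subtype.ext (hcg e)⟩

lemma ncard_range_le_of_refines {E β γ : Type*} [Finite E] [Nonempty γ] {b : E → β} {c : E → γ}
    (h : ∀ e e', b e = b e' → c e = c e') : (Set.range c).ncard ≤ (Set.range b).ncard := by
  obtain ⟨φ, rfl⟩ := (Function.factorsThrough_iff (f := b) c).1 fun e e' => h e e'
  rw [Set.range_comp]
  exact Set.ncard_image_le (Set.finite_range b)

/-- If the colour classes of `b` refine those of `c`, but `b` has no more colours than `c`, then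
they have the same colour classes. -/
lemma eq_of_eq_of_ncard_range_le {E β γ : Type*} [Finite E] [Nonempty γ] {b : E → β} {c : E → γ}
    (h : ∀ e e', b e = b e' → c e = c e') (hle : (Set.range b).ncard ≤ (Set.range c).ncard)
    {e e' : E} (hc : c e = c e') : b e = b e' := by
  obtain ⟨φ, rfl⟩ := (Function.factorsThrough_iff (f := b) c).1 fun e e' => h e e'
  rw [Set.range_comp] at hle
  have hinj := Set.injOn_of_ncard_image_eq
    (le_antisymm (Set.ncard_image_le (Set.finite_range b)) hle) (Set.finite_range b)
  exact hinj (Set.mem_range_self e) (Set.mem_range_self e') hc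

/-- The number of colours of a colouring without rainbow `H`, with colours from an arbitrary type,
is at most that of an extremal one. -/
lemma IsExtremalColoring.numColors_le {V W α : Type*} [Finite V] {G : SimpleGraph V}
    {H : SimpleGraph W} {c : EdgeLabeling G ℕ} (hc : IsExtremalColoring H c)
    {b : EdgeLabeling G α} (hb : RainbowFree H b) : numColors b ≤ numColors c := by
  obtain ⟨φ, hφ⟩ := Set.countable_iff_exists_injOn.1 (Set.finite_range b).countable
  have h1 : numColors (b.compRight φ) = numColors b := by
    rw [numColors, numColors, ← hφ.ncard_image]
    exact congrArg Set.ncard (Set.range_comp φ b)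
  rw [← h1]
  refine hc.2 _ fun ψ hψ => hb ψ fun e e' hee => hψ ?_
  exact congrArg φ hee

end Coloring

/-! ### Totally symmetric colourings and blow-ups of a transversal -/

section BlowUp

variable {ι : Type*} {t : ℕ}

/-- The colouring of the complete graph given by a colouring of all unordered pairs. -/
def restrictTop {α : Type*} (f : Sym2 ι → α) : TopEdgeLabeling ι α := fun e => f e

lemma mem_saturated_restrictTop {α : Type*} {f : Sym2 ι → α} {i : ι} {a : α} :
    a ∈ saturated (restrictTop f) i ↔ (∃ j, i ≠ j ∧ f s(i, j) = a) ∧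
      ∀ x y, x ≠ y → f s(x, y) = a → i = x ∨ i = y := by
  refine mem_saturated.trans ⟨fun ⟨⟨j, h, hj⟩, hall⟩ => ⟨⟨j, h, hj⟩, fun x y h => hall x y h⟩,
    fun ⟨⟨j, h, hj⟩, hall⟩ => ⟨⟨j, h, hj⟩, fun x y h => hall x y h⟩⟩

/-- The colour of an edge of a complete multipartite graph, given by two vertices in different
partite sets. -/
def edgeColor (c : EdgeLabeling (completeMultipartiteGraph (fun _ : ι => Fin t)) ℕ)
    (x y : Σ _ : ι, Fin t) (h : x.1 ≠ y.1) : ℕ := c.get x y h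

lemma edgeColor_comm (c : EdgeLabeling (completeMultipartiteGraph (fun _ : ι => Fin t)) ℕ)
    (x y : Σ _ : ι, Fin t) (h : x.1 ≠ y.1) : edgeColor c x y h = edgeColor c y x h.symm :=
  EdgeLabeling.get_comm _ _ _

open Classical in
/-- The colouring induced on a transversal of a complete multipartite graph. -/
noncomputable def transversalColoring
    (c : EdgeLabeling (completeMultipartiteGraph (fun _ : ι => Fin t)) ℕ) (z : Fin t) :
    Sym2 ι → ℕ :=
  Sym2.lift ⟨fun i j => if h : i ≠ j then edgeColor c ⟨i, z⟩ ⟨j, z⟩ h else 0, fun i j => by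
    by_cases h : i = j
    · simp [h]
    · simp only [ne_eq, h, Ne.symm h, not_false_eq_true, dif_pos]
      exact edgeColor_comm _ _ _ _⟩

variable {c : EdgeLabeling (completeMultipartiteGraph (fun _ : ι => Fin t)) ℕ} {z : Fin t}

lemma transversalColoring_mk {i j : ι} (h : i ≠ j) :
    transversalColoring c z s(i, j) = edgeColor c ⟨i, z⟩ ⟨j, z⟩ h := dif_pos h

/-- Used in contrapositive form: colours not saturated on the transversal are not saturated in c, so
the symmetry maps fix them. -/
lemma mem_saturated_transversal {i j : ι} (h : i ≠ j)
    (hs : edgeColor c ⟨i, z⟩ ⟨j, z⟩ h ∈ saturated c ⟨i, z⟩) :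
    transversalColoring c z s(i, j) ∈ saturated (restrictTop (transversalColoring c z)) i := by
  rw [mem_saturated_restrictTop]
  refine ⟨⟨j, h, rfl⟩, fun x y hxy hc => ?_⟩
  rw [transversalColoring_mk h, transversalColoring_mk hxy] at hc
  have := (mem_saturated.1 hs).2 ⟨x, z⟩ ⟨y, z⟩ hxy hc
  simpa using this

/-- Extending σ by the identity merges both clauses of symmetry into one map on colours. -/
lemma TotallySymmetric.exists_translation (hsym : TotallySymmetric c) (z : Fin t)
    (x : Σ _ : ι, Fin t) : ∃ τ : ℕ → ℕ,
      (∀ (y : Σ _ : ι, Fin t) (h : x.1 ≠ y.1), edgeColor c x y h = τ (edgeColor c ⟨x.1, z⟩ y h)) ∧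
        ∀ b, b ∉ saturated c ⟨x.1, z⟩ → τ b = b := by
  classical
  obtain ⟨-, -, σ, hσ⟩ := hsym x.1 z x.2
  refine ⟨fun b => if h : b ∈ saturated c ⟨x.1, z⟩ then σ ⟨b, h⟩ else b, fun y h => ?_,
    fun b hb => dif_neg hb⟩
  obtain ⟨h1, h2⟩ := hσ y h h
  by_cases hs : edgeColor c ⟨x.1, z⟩ y h ∈ saturated c ⟨x.1, z⟩
  · exact (h2 hs).trans (by beta_reduce; rw [dif_pos hs]; rfl)
  · exact (h1 hs).trans (by beta_reduce; rw [dif_neg hs]; rfl)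

/-- The colour of an edge in the blow-up of `restrictTop f`. -/
lemma blowUpColoring_mk {α : Type*} (f : Sym2 ι → α) {x y : Σ _ : ι, Fin t} (h : x.1 ≠ y.1) :
    blowUpColoring (restrictTop f) (fun _ => t) ⟨s(x, y), h⟩ = (f s(x.1, y.1),
      {z | (z = x ∨ z = y) ∧ f s(x.1, y.1) ∈ saturated (restrictTop f) z.1}) := by
  refine Prod.ext rfl (Set.ext fun z => ?_)
  change (z ∈ s(x, y) ∧ _) ↔ _
  rw [Sym2.mem_iff]
  rfl

/-- Both ends of an edge can be moved to the transversal, and moving an end that does not saturate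
the colour changes nothing. If both ends saturate it, the blow-up colour records both, so the two
edges coincide; if one does, they share that end; if none does, both carry the transversal colour.
-/
lemma eq_of_blowUpColoring_eq (hsym : TotallySymmetric c) (z : Fin t)
    {x y x' y' : Σ _ : ι, Fin t} (h : x.1 ≠ y.1) (h' : x'.1 ≠ y'.1)
    (hb : blowUpColoring (restrictTop (transversalColoring c z)) (fun _ => t) ⟨s(x, y), h⟩ =
      blowUpColoring (restrictTop (transversalColoring c z)) (fun _ => t) ⟨s(x', y'), h'⟩) :
    edgeColor c x y h = edgeColor c x' y' h' := by
  choose τ hτ hτ' using hsym.exists_translation z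
  set f := transversalColoring c z with hf
  have key : ∀ (x y : Σ _ : ι, Fin t) (h : x.1 ≠ y.1),
      f s(x.1, y.1) ∉ saturated (restrictTop f) y.1 → edgeColor c x y h = τ x (f s(x.1, y.1)) := by
    intro x y h hs
    have hns : edgeColor c ⟨y.1, z⟩ ⟨x.1, z⟩ h.symm ∉ saturated c ⟨y.1, z⟩ := fun hn =>
      hs (by rw [Sym2.eq_swap]; exact mem_saturated_transversal h.symm hn)
    rw [hτ x y h, edgeColor_comm, hτ y ⟨x.1, z⟩ h.symm, hτ' y _ hns,
      edgeColor_comm, hf, transversalColoring_mk h]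
  have key' : ∀ (x y : Σ _ : ι, Fin t) (h : x.1 ≠ y.1),
      f s(x.1, y.1) ∉ saturated (restrictTop f) x.1 →
      f s(x.1, y.1) ∉ saturated (restrictTop f) y.1 → edgeColor c x y h = f s(x.1, y.1) := by
    intro x y h hx hy
    rw [key x y h hy, hτ']
    intro hn
    refine hx (mem_saturated_transversal h ?_)
    rwa [← transversalColoring_mk h]
  have one : ∀ (x y x' y' : Σ _ : ι, Fin t) (h : x.1 ≠ y.1) (h' : x'.1 ≠ y'.1),
      f s(x.1, y.1) = f s(x'.1, y'.1) →
      (∀ w, ((w = x ∨ w = y) ∧ f s(x.1, y.1) ∈ saturated (restrictTop f) w.1) ↔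
        ((w = x' ∨ w = y') ∧ f s(x.1, y.1) ∈ saturated (restrictTop f) w.1)) →
      f s(x.1, y.1) ∈ saturated (restrictTop f) x.1 → edgeColor c x y h = edgeColor c x' y' h' := by
    intro x y x' y' h h' hfe hw hx
    by_cases hy : f s(x.1, y.1) ∈ saturated (restrictTop f) y.1
    · have h1 := ((hw x).1 ⟨Or.inl rfl, hx⟩).1
      have h2 := ((hw y).1 ⟨Or.inr rfl, hy⟩).1
      rcases h1 with rfl | rfl <;> rcases h2 with rfl | rfl
      · exact absurd rfl h
      · rfl
      · exact edgeColor_comm _ _ _ _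
      · exact absurd rfl h
    · rcases ((hw x).1 ⟨Or.inl rfl, hx⟩).1 with rfl | rfl
      · rw [key x y h hy, key x y' h', hfe]
        intro hy'
        rcases ((hw y').2 ⟨Or.inr rfl, hfe ▸ hy'⟩).1 with rfl | rfl
        · exact h' rfl
        · exact hy (hfe ▸ hy')
      · rw [edgeColor_comm c x' x, key x y h hy, key x x' h'.symm, hfe, Sym2.eq_swap]
        rw [Sym2.eq_swap]
        intro hy'
        rcases ((hw x').2 ⟨Or.inl rfl, hfe ▸ hy'⟩).1 with rfl | rfl
        · exact h' rfl
        · exact hy (hfe ▸ hy')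
  rw [blowUpColoring_mk, blowUpColoring_mk, Prod.mk.injEq] at hb
  obtain ⟨hfe, hset⟩ := hb
  rw [← hfe, Set.ext_iff] at hset
  by_cases hx : f s(x.1, y.1) ∈ saturated (restrictTop f) x.1
  · exact one x y x' y' h h' hfe hset hx
  by_cases hy : f s(x.1, y.1) ∈ saturated (restrictTop f) y.1
  · rw [edgeColor_comm]
    rw [Sym2.eq_swap] at hfe hy hset
    exact one y x x' y' h.symm h' hfe (fun w => (and_congr_left' or_comm).trans (hset w)) hy
  · have hx' : f s(x'.1, y'.1) ∉ saturated (restrictTop f) x'.1 := by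
      intro hn
      rw [← hfe] at hn
      rcases ((hset x').2 ⟨Or.inl rfl, hn⟩).1 with rfl | rfl
      · exact hx hn
      · exact hy hn
    have hy' : f s(x'.1, y'.1) ∉ saturated (restrictTop f) y'.1 := by
      intro hn
      rw [← hfe] at hn
      rcases ((hset y').2 ⟨Or.inr rfl, hn⟩).1 with rfl | rfl
      · exact hx hn
      · exact hy hn
    rw [key' x y h hx hy, key' x' y' h' hx' hy', hfe]

lemma not_rainbowOn_transversalColoring [DecidableEq ι] {k : ℕ}
    (hc : RainbowFree (completeGraph (Fin k)) c) (z : Fin t) {X : Finset ι} (hX : X.card = k) :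
    ¬ RainbowOn (transversalColoring c z) X := by
  intro hXf
  let e := X.equivFinOfCardEq hX
  have hne : ∀ i j, i ≠ j → (e.symm i : ι) ≠ e.symm j := fun i j hij h =>
    hij (e.symm.injective (Subtype.ext h))
  refine rainbowFree_completeGraph_iff.1 hc (fun i => ⟨e.symm i, z⟩) hne ?_
  intro i j i' j' h h' hcol
  change edgeColor c _ _ (hne i j h) = edgeColor c _ _ (hne i' j' h') at hcol
  rw [← transversalColoring_mk (hne i j h), ← transversalColoring_mk (hne i' j' h')] at hcol
  have := hXf (mk_mem_pairs.2 ⟨(e.symm i).2, (e.symm j).2, hne i j h⟩)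
    (mk_mem_pairs.2 ⟨(e.symm i').2, (e.symm j').2, hne i' j' h'⟩) hcol
  exact Sym2.map.injective (f := fun i => (e.symm i : ι))
    (Subtype.val_injective.comp e.symm.injective) this

/-- A rainbow clique projects to a rainbow clique: if two projected edges share a colour, any vertex
saturating it lies on both, and the clique has only one vertex over it. So the recorded sets of ends
agree as well. -/
lemma rainbowFree_blowUpColoring [DecidableEq ι] {α : Type*} {k : ℕ} {f : Sym2 ι → α}
    (hf : ∀ X : Finset ι, X.card = k → ¬ RainbowOn f X) :
    RainbowFree (completeGraph (Fin k)) (blowUpColoring (restrictTop f) (fun _ => t)) := by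
  rw [rainbowFree_completeGraph_iff]
  intro g hg hinj
  have hne : ∀ i j, i ≠ j → (g i).1 ≠ (g j).1 := hg
  have hginj : Function.Injective fun i => (g i).1 := fun i j hij =>
    by_contra fun h => hne i j h hij
  refine hf (univ.image fun i => (g i).1) (by simp [card_image_of_injective _ hginj]) ?_
  intro e he e' he' hee
  induction e using Sym2.ind with
  | _ a b =>
    induction e' using Sym2.ind with
    | _ a' b' =>
      simp only [mem_coe, mk_mem_pairs, mem_image, mem_univ, true_and] at he he'
      obtain ⟨⟨i, rfl⟩, ⟨j, rfl⟩, hij⟩ := he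
      obtain ⟨⟨i', rfl⟩, ⟨j', rfl⟩, hij'⟩ := he'
      have hs : s(i, j) = s(i', j') := by
        refine hinj i j i' j' (fun h => hij (h ▸ rfl)) (fun h => hij' (h ▸ rfl)) ?_
        refine (blowUpColoring_mk f hij).trans (Eq.trans ?_ (blowUpColoring_mk f hij').symm)
        refine Prod.ext hee (Set.ext fun w => ?_)
        simp only [Set.mem_ofPred_eq, ← hee]
        refine and_congr_left fun hw => ?_
        obtain ⟨-, hw⟩ := mem_saturated_restrictTop.1 hw
        constructor
        · rintro (rfl | rfl)
          all_goals
            rcases hw _ _ hij' hee.symm with h | h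
            · exact Or.inl (congrArg g (hginj h))
            · exact Or.inr (congrArg g (hginj h))
        · rintro (rfl | rfl)
          all_goals
            rcases hw _ _ hij rfl with h | h
            · exact Or.inl (congrArg g (hginj h))
            · exact Or.inr (congrArg g (hginj h))
      exact congrArg (Sym2.map fun i => (g i).1) hs

end BlowUp

end AntiRamsey

namespace AntiRamsey

open SimpleGraph Finset

/-! ### Counting colours in blow-ups -/

section Counting

lemma sum_sigma_const {ι : Type*} [Fintype ι] {t : ℕ} (w : ι → ι → ℕ) :
    ∑ x : Σ _ : ι, Fin t, ∑ y : Σ _ : ι, Fin t, w x.1 y.1 = t ^ 2 * ∑ i, ∑ j, w i j := by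
  have h (g : ι → ℕ) : ∑ x : Σ _ : ι, Fin t, g x.1 = t * ∑ i, g i := by
    rw [Fintype.sum_sigma, mul_sum]
    refine sum_congr rfl fun i _ => ?_
    change ∑ _ : Fin t, g i = _
    simp
  simp_rw [h]
  rw [h fun i => t * ∑ j, w i j, ← mul_sum]
  ring

variable {ι : Type*} [Fintype ι] {t : ℕ}

lemma card_edgeFinset_comap_fst (L : SimpleGraph ι) [DecidableRel L.Adj] (t : ℕ) :
    (L.comap (Sigma.fst : (Σ _ : ι, Fin t) → ι)).edgeFinset.card = t ^ 2 * L.edgeFinset.card := by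
  have h1 := adjCount_univ (L.comap (Sigma.fst : (Σ _ : ι, Fin t) → ι))
  have h2 := adjCount_univ L
  have h3 : adjCount (L.comap (Sigma.fst : (Σ _ : ι, Fin t) → ι)) univ univ =
      t ^ 2 * adjCount L univ univ := by
    have h4 : adjCount (L.comap (Sigma.fst : (Σ _ : ι, Fin t) → ι)) univ univ =
        ∑ x : Σ _ : ι, Fin t, ∑ y : Σ _ : ι, Fin t, if L.Adj x.1 y.1 then 1 else 0 :=
      sum_congr rfl fun x _ => sum_congr rfl fun y _ => if_congr Iff.rfl rfl rfl
    rw [h4, adjCount]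
    exact sum_sigma_const fun i j => if L.Adj i j then 1 else 0
  rw [h1, h2] at h3
  linarith

variable [DecidableEq ι]

/-- Colour the edges over `L` with different colours and all other edges with one more colour. -/
lemma exists_rainbowFree_coloring {k : ℕ} {L : SimpleGraph ι} [DecidableRel L.Adj] (ht : 0 < t)
    (hk : 0 < k) (hkn : k ≤ Fintype.card ι)
    (hL : ∀ X : Finset ι, X.card = k → ¬ IsNearClique L X) :
    ∃ c : EdgeLabeling (completeMultipartiteGraph (fun _ : ι => Fin t)) ℕ,
      RainbowFree (completeGraph (Fin k)) c ∧ t ^ 2 * L.edgeFinset.card + 1 ≤ numColors c := by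
  let M := L.comap (Sigma.fst : (Σ _ : ι, Fin t) → ι)
  obtain ⟨φ, hφ⟩ := exists_injective_nat (Sym2 (Σ _ : ι, Fin t))
  let h : Sym2 (Σ _ : ι, Fin t) → ℕ := fun e => if e ∈ M.edgeFinset then φ e + 1 else 0
  have h0 : ∀ x y : Σ _ : ι, Fin t, ¬ L.Adj x.1 y.1 → h s(x, y) = 0 := fun x y hxy =>
    if_neg (by simpa [M] using hxy)
  refine ⟨fun e => h e, ?_, ?_⟩
  · refine rainbowFree_completeGraph_iff.2 fun g hg hinj => ?_
    have hginj : Function.Injective fun i => (g i).1 := fun i j hij =>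
      by_contra fun h => hg i j h hij
    refine hL (univ.image fun i => (g i).1) (by simp [card_image_of_injective _ hginj]) ?_
    by_cases hex : ∃ i j, i ≠ j ∧ ¬ L.Adj (g i).1 (g j).1
    · obtain ⟨i, j, hij, hadj⟩ := hex
      refine ⟨s((g i).1, (g j).1), ?_⟩
      simp only [mem_image, mem_univ, true_and]
      rintro _ ⟨i', rfl⟩ _ ⟨j', rfl⟩ hne hne'
      by_contra hadj'
      refine hne' (congrArg (Sym2.map fun i => (g i).1) (hinj i' j' i j ?_ hij ?_))
      · exact fun h => hne (h ▸ rfl)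
      · exact (h0 _ _ hadj').trans (h0 _ _ hadj).symm
    · push Not at hex
      refine ⟨s((g ⟨0, hk⟩).1, (g ⟨0, hk⟩).1), ?_⟩
      simp only [mem_image, mem_univ, true_and]
      rintro _ ⟨i', rfl⟩ _ ⟨j', rfl⟩ hne -
      exact hex i' j' fun h => hne (h ▸ rfl)
  · have hsub : ((insert 0 (M.edgeFinset.image fun e => φ e + 1) : Finset ℕ) : Set ℕ) ⊆
        Set.range fun e : (completeMultipartiteGraph (fun _ : ι => Fin t)).edgeSet => h e := by
      intro a ha
      rcases mem_insert.1 (mem_coe.1 ha) with rfl | ha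
      -- Colour 0 really occurs: a k-set that is not a near clique contains a non-edge of L.
      · obtain ⟨X, -, hX⟩ := exists_subset_card_eq (s := (univ : Finset ι)) (n := k) hkn
        obtain ⟨x, hx⟩ : X.Nonempty := card_pos.1 (by omega)
        have := hL X hX
        simp only [IsNearClique, not_exists, not_forall] at this
        obtain ⟨a, -, b, -, hab, -, hadj⟩ := this s(x, x)
        exact ⟨⟨s(⟨a, ⟨0, ht⟩⟩, ⟨b, ⟨0, ht⟩⟩), hab⟩, h0 _ _ hadj⟩
      · obtain ⟨e, he, rfl⟩ := mem_image.1 ha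
        refine ⟨⟨e, ?_⟩, if_pos he⟩
        induction e using Sym2.ind with
        | _ x y =>
          have hxy : L.Adj x.1 y.1 := by simpa [M] using he
          exact hxy.ne
    have hle := Set.ncard_le_ncard hsub (Set.finite_range _)
    rw [Set.ncard_coe_finset, card_insert_of_notMem (by simp), card_image_of_injective _
      (fun a b hab => hφ (Nat.succ_injective hab)), card_edgeFinset_comap_fst] at hle
    exact hle

/-- Deleting one end of the exceptional pair would leave a clique on p + 1 vertices. -/
lemma turanGraph_not_isNearClique {p : ℕ} (hp : 0 < p) (n : ℕ) (X : Finset (Fin n))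
    (hX : X.card = p + 2) : ¬ IsNearClique (turanGraph n p) X := by
  rintro ⟨e₀, he₀⟩
  induction e₀ using Sym2.ind with
  | _ u v =>
    have hc : p + 1 ≤ (X.erase u).card := by
      have := pred_card_le_card_erase (s := X) (a := u)
      omega
    obtain ⟨Y, hYX, hY⟩ := exists_subset_card_eq hc
    refine turanGraph_cliqueFree (n := n) hp Y ⟨fun a ha b hb hab => ?_, hY⟩
    obtain ⟨hau, ha⟩ := mem_erase.1 (hYX ha)
    obtain ⟨hbu, hb⟩ := mem_erase.1 (hYX hb)
    refine he₀ a ha b hb hab fun h => ?_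
    rcases Sym2.eq_iff.1 h with ⟨h, -⟩ | ⟨-, h⟩
    · exact hau h
    · exact hbu h

/-- The colour `a` appears on exactly one edge of the complete graph. -/
def IsSingle {α : Type*} (f : Sym2 ι → α) (a : α) : Prop :=
  ∃ e ∈ pairs univ, f e = a ∧ ∀ e' ∈ pairs univ, f e' = a → e' = e

variable {α : Type*}

/-- The graph of the edges whose colour appears only once. -/
def singleGraph (f : Sym2 ι → α) : SimpleGraph ι where
  Adj i j := i ≠ j ∧ IsSingle f (f s(i, j))
  symm := ⟨fun i j h => ⟨h.1.symm, by rw [Sym2.eq_swap]; exact h.2⟩⟩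
  loopless := ⟨fun _ h => h.1 rfl⟩

lemma eq_of_isSingle {f : Sym2 ι → α} {e e' : Sym2 ι} (hs : IsSingle f (f e))
    (he : e ∈ pairs univ) (he' : e' ∈ pairs univ) (h : f e = f e') : e = e' := by
  obtain ⟨e₁, -, -, hall⟩ := hs
  rw [hall e he rfl, hall e' he' h.symm]

lemma mem_edgeSet_singleGraph {f : Sym2 ι → α} {e : Sym2 ι} (he : e ∈ pairs univ) :
    e ∈ (singleGraph f).edgeSet ↔ IsSingle f (f e) := by
  induction e using Sym2.ind with
  | _ i j =>
    have := (mk_mem_pairs.1 he).2.2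
    exact ⟨fun h => h.2, fun h => ⟨this, h⟩⟩

/-- Of two distinct edges at least one is not the exceptional pair, and its colour occurs nowhere
else. -/
lemma rainbowOn_of_isNearClique {f : Sym2 ι → α} {X : Finset ι}
    (hX : IsNearClique (singleGraph f) X) : RainbowOn f X := by
  obtain ⟨e₀, he₀⟩ := hX
  have key : ∀ e ∈ pairs X, e ∈ pairs univ ∧ (e ≠ e₀ → IsSingle f (f e)) := by
    intro e he
    induction e using Sym2.ind with
    | _ i j =>
      obtain ⟨hi, hj, hij⟩ := mk_mem_pairs.1 he
      exact ⟨mk_mem_pairs.2 ⟨mem_univ _, mem_univ _, hij⟩, fun h => (he₀ i hi j hj hij h).2⟩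
  intro e he e' he' hee
  obtain ⟨h1, h2⟩ := key e he
  obtain ⟨h1', h2'⟩ := key e' he'
  by_cases h : e = e₀
  · by_cases h' : e' = e₀
    · rw [h, h']
    · exact (eq_of_isSingle (h2' h') h1' h1 hee.symm).symm
  · exact eq_of_isSingle (h2 h) h1 h1' hee

lemma isRainbowPlusOne_singleGraph {f : Sym2 ι → α} {a : α} (ha : ¬ IsSingle f a)
    (hall : ∀ e ∈ pairs univ, ¬ IsSingle f (f e) → f e = a) :
    IsRainbowPlusOne (restrictTop f) (singleGraph f) := by
  have hpairs : ∀ e : (⊤ : SimpleGraph ι).edgeSet, (e : Sym2 ι) ∈ pairs univ := by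
    rintro ⟨e, he⟩
    induction e using Sym2.ind with
    | _ i j => exact mk_mem_pairs.2 ⟨mem_univ _, mem_univ _, he⟩
  refine ⟨fun e₁ e₂ h₁ _ hc => Subtype.ext ?_, a, fun e => ?_⟩
  · exact eq_of_isSingle ((mem_edgeSet_singleGraph (hpairs e₁)).1 h₁) (hpairs e₁) (hpairs e₂) hc
  · rw [mem_edgeSet_singleGraph (hpairs e)]
    refine ⟨hall e (hpairs e), fun h hs => ha ?_⟩
    rw [← h]
    exact hs

variable [DecidableEq α]

open Classical in
/-- The number of colours in a blow-up. -/
lemma numColors_blowUpColoring_le (ht : 0 < t) (f : Sym2 ι → α) :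
    numColors (blowUpColoring (restrictTop f) (fun _ => t)) ≤
      t ^ 2 * ((colors f univ).filter (IsSingle f)).card +
        t * ((colors f univ).filter fun a => ¬ IsSingle f a).card := by
  let b : (Σ _ : ι, Fin t) → (Σ _ : ι, Fin t) → α × Set (Σ _ : ι, Fin t) := fun x y =>
    (f s(x.1, y.1), {z | (z = x ∨ z = y) ∧ f s(x.1, y.1) ∈ saturated (restrictTop f) z.1})
  have hb : ∀ x y, b x y = b y x := by
    intro x y
    simp only [b, Sym2.eq_swap (a := x.1), or_comm (a := _ = x)]
  let B := (univ.offDiag.filter fun q : (Σ _ : ι, Fin t) × (Σ _ : ι, Fin t) =>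
    q.1.1 ≠ q.2.1).image fun q => b q.1 q.2
  have hrange : Set.range (blowUpColoring (restrictTop f) (fun _ => t)) ⊆ B := by
    rintro _ ⟨⟨e, he⟩, rfl⟩
    induction e using Sym2.ind with
    | _ x y =>
      have hxy : x.1 ≠ y.1 := he
      refine mem_coe.2 (mem_image.2 ⟨(x, y), ?_, (blowUpColoring_mk f hxy).symm⟩)
      simp only [mem_filter, mem_offDiag, mem_univ, true_and]
      exact ⟨fun h => hxy (h ▸ rfl), hxy⟩
  have hB : ∀ β ∈ B, ∃ x y : Σ _ : ι, Fin t, x.1 ≠ y.1 ∧ b x y = β := by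
    intro β hβ
    obtain ⟨⟨x, y⟩, hq, rfl⟩ := mem_image.1 hβ
    exact ⟨x, y, (mem_filter.1 hq).2, rfl⟩
  have hmaps : ∀ β ∈ B, β.1 ∈ colors f univ := by
    intro β hβ
    obtain ⟨x, y, hxy, rfl⟩ := hB β hβ
    exact mem_colors.2 ⟨_, mem_univ _, _, mem_univ _, hxy, rfl⟩
  have hfiber : ∀ a ∈ colors f univ, (B.filter fun β => β.1 = a).card ≤
      if IsSingle f a then t ^ 2 else t := by
    intro a _
    split_ifs with hs
    · obtain ⟨e, he, rfl, hall⟩ := hs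
      induction e using Sym2.ind with
      | _ i j =>
        have hsub : (B.filter fun β => β.1 = f s(i, j)) ⊆
            univ.image fun q : Fin t × Fin t => b ⟨i, q.1⟩ ⟨j, q.2⟩ := by
          intro β hβ
          obtain ⟨hβ, hβa⟩ := mem_filter.1 hβ
          obtain ⟨⟨i', q⟩, ⟨j', q'⟩, hxy, rfl⟩ := hB β hβ
          have := hall s(i', j') (mk_mem_pairs.2 ⟨mem_univ _, mem_univ _, hxy⟩) hβa
          rcases Sym2.eq_iff.1 this with ⟨rfl, rfl⟩ | ⟨rfl, rfl⟩
          · exact mem_image.2 ⟨(q, q'), mem_univ _, rfl⟩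
          · exact mem_image.2 ⟨(q', q), mem_univ _, hb _ _⟩
        refine (card_le_card hsub).trans (card_image_le.trans ?_)
        simp [sq]
    · by_cases hv : ∃ v, a ∈ saturated (restrictTop f) v
      · obtain ⟨v, hv⟩ := hv
        have hsub : (B.filter fun β => β.1 = a) ⊆
            univ.image fun q : Fin t => (a, {(⟨v, q⟩ : Σ _ : ι, Fin t)}) := by
          have main : ∀ (q : Fin t) (y : Σ _ : ι, Fin t), v ≠ y.1 → f s(v, y.1) = a →
              (a, {(⟨v, q⟩ : Σ _ : ι, Fin t)}) = b ⟨v, q⟩ y := by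
            intro q y hy hfa
            refine Prod.ext hfa.symm (Set.ext fun w => ?_)
            simp only [b, hfa, Set.mem_singleton_iff, Set.mem_ofPred_eq]
            constructor
            · rintro rfl
              exact ⟨Or.inl rfl, hv⟩
            · rintro ⟨rfl | rfl, hw⟩
              · rfl
              -- A second saturating vertex would confine the colour to a single edge, so only the
              -- copy of v is recorded.
              · refine absurd ⟨s(v, w.1), mk_mem_pairs.2 ⟨mem_univ _, mem_univ _, hy⟩, hfa, ?_⟩ hs
                intro e' he' hfe'
                induction e' using Sym2.ind with
                | _ i j =>
                  have hij := (mk_mem_pairs.1 he').2.2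
                  have h1 := (mem_saturated_restrictTop.1 hv).2 i j hij hfe'
                  have h2 := (mem_saturated_restrictTop.1 hw).2 i j hij hfe'
                  rcases h1 with rfl | rfl <;> rcases h2 with h2 | h2
                  · exact absurd h2.symm hy
                  · rw [h2]
                  · rw [h2, Sym2.eq_swap]
                  · exact absurd h2.symm hy
          intro β hβ
          obtain ⟨hβ, hβa⟩ := mem_filter.1 hβ
          obtain ⟨⟨i, q⟩, ⟨j, q'⟩, hxy, rfl⟩ := hB β hβ
          rcases (mem_saturated_restrictTop.1 hv).2 i j hxy hβa with rfl | rfl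
          · exact mem_image.2 ⟨q, mem_univ _, main q ⟨j, q'⟩ hxy hβa⟩
          · refine mem_image.2 ⟨q', mem_univ _, ?_⟩
            rw [hb]
            exact main q' ⟨i, q⟩ hxy.symm (by rw [Sym2.eq_swap]; exact hβa)
        exact (card_le_card hsub).trans (card_image_le.trans (by simp))
      · have hsub : (B.filter fun β => β.1 = a) ⊆ {(a, ∅)} := by
          intro β hβ
          obtain ⟨hβ, hβa⟩ := mem_filter.1 hβ
          obtain ⟨x, y, hxy, rfl⟩ := hB β hβ
          refine mem_singleton.2 (Prod.ext hβa (Set.eq_empty_of_forall_notMem ?_))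
          rintro w ⟨-, hw⟩
          exact hv ⟨w.1, hβa ▸ hw⟩
        exact (card_le_card hsub).trans (by rw [card_singleton]; exact ht)
  calc numColors (blowUpColoring (restrictTop f) (fun _ => t)) ≤ B.card := by
        rw [← Set.ncard_coe_finset]
        exact Set.ncard_le_ncard hrange B.finite_toSet
    _ = ∑ a ∈ colors f univ, (B.filter fun β => β.1 = a).card := card_eq_sum_card_fiberwise hmaps
    _ ≤ ∑ a ∈ colors f univ, if IsSingle f a then t ^ 2 else t := sum_le_sum hfiber
    _ = _ := by
        rw [sum_ite, sum_const, sum_const, smul_eq_mul, smul_eq_mul, mul_comm, mul_comm t]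

open Classical in
lemma card_edgeFinset_singleGraph (f : Sym2 ι → α) :
    (singleGraph f).edgeFinset.card = ((colors f univ).filter (IsSingle f)).card := by
  have hpairs : ∀ e ∈ (singleGraph f).edgeFinset, e ∈ pairs univ := by
    intro e he
    induction e using Sym2.ind with
    | _ i j => exact mk_mem_pairs.2 ⟨mem_univ _, mem_univ _, (mem_edgeFinset.1 he).1⟩
  have himage : (singleGraph f).edgeFinset.image f = (colors f univ).filter (IsSingle f) := by
    ext a
    simp only [mem_image, mem_filter, colors]
    constructor
    · rintro ⟨e, he, rfl⟩
      exact ⟨⟨e, hpairs e he, rfl⟩,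
        (mem_edgeSet_singleGraph (hpairs e he)).1 (mem_edgeFinset.1 he)⟩
    · rintro ⟨⟨e, he, rfl⟩, hs⟩
      exact ⟨e, mem_edgeFinset.2 ((mem_edgeSet_singleGraph he).2 hs), rfl⟩
  rw [← himage, card_image_of_injOn]
  intro e he e' he' hee
  exact eq_of_isSingle ((mem_edgeSet_singleGraph (hpairs e he)).1 (mem_edgeFinset.1 he))
    (hpairs e he) (hpairs e' he') hee

end Counting

end AntiRamsey

/-! ### Identifying the transversal colouring -/

theorem mainTheorem5 (r k t : ℕ) (hk : 4 ≤ k) (hr : k < r) (ht : 2 ≤ t)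
    (c : SimpleGraph.EdgeLabeling
      (SimpleGraph.completeMultipartiteGraph (fun _ : Fin r => Fin t)) ℕ)
    (hext : AntiRamsey.IsExtremalColoring (SimpleGraph.completeGraph (Fin k)) c)
    (hsym : AntiRamsey.TotallySymmetric c) :
    ∃ (cK : SimpleGraph.TopEdgeLabeling (Fin r) ℕ)
      (ρ : SimpleGraph.completeMultipartiteGraph (fun _ : Fin r => Fin t) ≃g
        AntiRamsey.blowUp (⊤ : SimpleGraph (Fin r)) (fun _ => t)),
      (∀ x, ρ x = x) ∧
      AntiRamsey.IsColoredIso c (AntiRamsey.blowUpColoring cK (fun _ => t)) ρ ∧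
      ∃ L : SimpleGraph (Fin r), AntiRamsey.IsRainbowPlusOne cK L ∧
        ((k = 4 ∧ r = 5 ∧
            (Nonempty (L ≃g AntiRamsey.hourglass) ∨ Nonempty (L ≃g AntiRamsey.house))) ∨
          (k = 4 ∧ r = 6 ∧ Nonempty (L ≃g AntiRamsey.prism)) ∨
          Nonempty (L ≃g SimpleGraph.turanGraph r (k - 2))) := by
  classical
  open AntiRamsey SimpleGraph Finset in
  obtain ⟨p, rfl⟩ : ∃ p, k = p + 2 := ⟨k - 2, by omega⟩
  have hp : 2 ≤ p := by omega
  let z : Fin t := ⟨0, by omega⟩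
  set f := transversalColoring c z with hf
  have hfree : ∀ X : Finset (Fin r), X.card = p + 2 → ¬ RainbowOn f X := fun X hX =>
    not_rainbowOn_transversalColoring hext.1 z hX
  let b : EdgeLabeling (completeMultipartiteGraph (fun _ : Fin r => Fin t))
    (ℕ × Set (Σ _ : Fin r, Fin t)) := blowUpColoring (restrictTop f) (fun _ => t)
  have hbfree : RainbowFree (completeGraph (Fin (p + 2))) b := rainbowFree_blowUpColoring hfree
  have hble : numColors b ≤ numColors c := hext.numColors_le hbfree
  have hbc : ∀ e e', b e = b e' → c e = c e' := by
    rintro ⟨e, he⟩ ⟨e', he'⟩ hee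
    induction e using Sym2.ind with
    | _ x y =>
      induction e' using Sym2.ind with
      | _ x' y' => exact eq_of_blowUpColoring_eq hsym z he he' hee
  -- The colouring b refines c without having more colours, so the classes agree.
  have hcb : ∀ e e', c e = c e' → b e = b e' := fun e e' h => eq_of_eq_of_ncard_range_le hbc hble h
  have hcle : numColors c ≤ numColors b :=
    ncard_range_le_of_refines hbc
  obtain ⟨c', hc', hc'n⟩ := exists_rainbowFree_coloring (t := t) (k := p + 2) (by omega) (by omega)
    (by rw [Fintype.card_fin]; omega) (turanGraph_not_isNearClique (by omega) r)
  rw [card_edgeFinset_turanGraph_eq (by omega)] at hc'n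
  have hlow := hc'n.trans ((hext.2 c' hc').trans hcle)
  have hup := hlow.trans (numColors_blowUpColoring_le (by omega) f)
  have hcol : (colors f univ).card ≤ turanNumber p r + 1 :=
    card_colors_le hp r (by omega) univ (by simp) fun X _ hX => hfree X hX
  rw [← card_filter_add_card_filter_not (s := colors f univ) (IsSingle f)] at hcol
  have hpos : 0 < ((colors f univ).filter fun a => ¬ IsSingle f a).card := by
    by_contra! h0
    rw [Nat.le_zero, card_eq_zero, filter_eq_empty_iff] at h0
    obtain ⟨X, -, hX⟩ := exists_subset_card_eq (s := (univ : Finset (Fin r))) (n := p + 2)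
      (by rw [card_univ, Fintype.card_fin]; omega)
    refine hfree X hX (RainbowOn.mono ?_ (subset_univ X))
    intro e he e' he' hee
    exact eq_of_isSingle (not_not.1 (h0 (mem_image_of_mem f he))) he he' hee
  generalize hm : ((colors f univ).filter (IsSingle f)).card = m at *
  generalize hn' : ((colors f univ).filter fun a => ¬ IsSingle f a).card = n' at *
  -- If m = T - (d + 1), then n' ≤ d + 2 and t²(d + 1) + 1 ≤ t(d + 2). This contradicts t ≥ 2, since
  -- t²(d + 1) ≥ 2t(d + 1) ≥ t(d + 2).
  have hmT : turanNumber p r ≤ m := by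
    by_contra! hlt
    obtain ⟨d, hd⟩ := Nat.exists_eq_add_of_lt hlt
    rw [hd] at hup hcol
    have h1 : n' ≤ d + 2 := by omega
    have h2 : t * n' ≤ t * (d + 2) := Nat.mul_le_mul_left _ h1
    nlinarith [Nat.mul_le_mul_right (t * (d + 1)) ht]
  have hmT' : m = turanNumber p r := by omega
  obtain ⟨a, ha⟩ := card_eq_one.1 (hn'.trans (by omega))
  have haS : ¬ IsSingle f a := (mem_filter.1 (ha.symm.subset (mem_singleton_self a))).2
  have hiso := iso_of_card_edgeFinset_eq (G := singleGraph f) hp (by rw [Fintype.card_fin]; omega)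
    (fun X hX hn => hfree X hX (rainbowOn_of_isNearClique hn))
    (by rw [card_edgeFinset_singleGraph, hm, hmT', Fintype.card_fin])
  let ρ : completeMultipartiteGraph (fun _ : Fin r => Fin t) ≃g
      blowUp (⊤ : SimpleGraph (Fin r)) (fun _ => t) := ⟨Equiv.refl _, Iff.rfl⟩
  refine ⟨restrictTop f, ρ, fun x => rfl, ?_, singleGraph f, ?_, ?_⟩
  · refine isColoredIso_of_forall_iff fun e e' => ?_
    have hmap : ∀ e, b e = blowUpColoring (restrictTop f) (fun _ => t)
        (ρ.mapEdgeSet e) := by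
      rintro ⟨e, he⟩
      induction e using Sym2.ind with
      | _ x y => rfl
    rw [← hmap, ← hmap]
    exact ⟨hcb e e', hbc e e'⟩
  · refine isRainbowPlusOne_singleGraph haS fun e he hs => ?_
    have : f e ∈ (colors f univ).filter fun a => ¬ IsSingle f a :=
      mem_filter.2 ⟨mem_image_of_mem f he, hs⟩
    rwa [ha, mem_singleton] at this
  · rw [Fintype.card_fin] at hiso
    rcases hiso with ⟨rfl, h⟩ | ⟨rfl, h⟩ | h
    · exact Or.inl ⟨rfl, h⟩
    · exact Or.inr (Or.inl ⟨rfl, h⟩)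
    · exact Or.inr (Or.inr h)
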